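/- Conventions. All graphs are finite. A tripartite 3-graph $H=(U\cup V\cup W,F)$ is a 3-uniform hypergraph on the disjoint union $U\cup V\cup W$, each of whose edges meets each of $U,V,W$ in at most one vertex. Write $K_2[X,Y]$ for the set of pairs $xy$ with $x\in X$, $y\in Y$, $x\ne y$, and $N_H(yz)=\{x: xyz\in F\}$. The slice graph $H_x$ has vertex set $V(H)$ and edges $\{yz: xyz\in F\}$; $E(H_x)^1$ is its edge set and $E(H_x)^0$ the set of the other pairs of distinct vertices. The VC-dimension of a graph is the largest $k$ for which there are vertices $a_i$ ($i\in[k]$) and $b_S$ ($S\subseteq[k]$) with $a_ib_S$ an edge if and only if $i\in S$, and $\mathrm{SVC}(H)=\max_{x\in V(H)}\mathrm{VC}(H_x)$. A set $X\subseteq V$ is almost $\eta$-good with respect to $H$ if at least $(1-\eta)|U||W|$ pairs $(y,z)\in U\times W$ satisfy $|N_H(yz)\cap X|/|X|\in[0,\eta)\cup(1-\eta,1]$; a partition $\mathcal P$ of $V$ is almost $\eta$-good if there is $\mathcal P'\subseteq\mathcal P$ with $|\bigcup\mathcal P'|\ge(1-\eta)|V|$ all of whose members are almost $\eta$-good. A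 bipartite edge-colored graph $(A\cup B,E_0,E_1,E_2)$ consists of disjoint sets $A,B$ and a partition $K_2[A,B]=E_0\sqcup E_1\sqcup E_2$. It has an $E_0/E_1$-copy of $U(k)$ if there are vertices $x_i$ ($i\in[k]$) in one of $A,B$ and $y_S$ ($S\subseteq[k]$) in the other such that $x_iy_S\in E_0$ when $i\in S$ and $x_iy_S\in E_1$ when $i\notin S$. A pair of partitions $(\mathcal P_A,\mathcal P_B)$ of $A$ and $B$ is $\eta$-homogeneous if there are $\Sigma_0,\Sigma_1\subseteq\mathcal P_A\times\mathcal P_B$ with $|\bigcup_{(X,Y)\in\Sigma_0\cup\Sigma_1}K_2[X,Y]|\ge(1-\eta)|A||B|$ and $|E_\tau\cap K_2[X,Y]|\ge(1-\eta)|X||Y|$ for all $\tau\in\{0,1\}$ and $(X,Y)\in\Sigma_\tau$. For $k\ge1$ call $c>0$ a removal constant for $k$ if for all $0<\epsilon,\delta<1/2$ with $\epsilon\le c^{-4}(\delta/8)^{4k+4}/8$, every bipartite edge-colored graph $(A\cup B,E_0,E_1,E_2)$ with $|E_2|\le\epsilon|A||B|$ and without $E_0/E_1$-copy of $U(k)$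 has a $2\delta^{1/16}$-homogeneous pair of partitions $(\mathcal P_A,\mathcal P_B)$ with $\max\{|\mathcal P_A|,|\mathcal P_B|\}\le 2c(\delta/8)^{-k}$. Proposition. Let $k\ge1$. Removal constants for $k$ exist. Let $c$ be any removal constant for $k$, and let $\ell\ge1$. Then there is $\epsilon_0>0$ (depending on $k,c,\ell$) such that for every $0<\epsilon<\epsilon_0$ there is $n_0$ such that the following holds with $\mu=8(16\epsilon^{1/16}c^4)^{1/(4k+4)}$. Let $1\le r,s\le\ell$ and assume: 1. $H=(U\cup V\cup W,F)$ is a tripartite 3-graph with at least $n_0$ vertices and $\mathrm{SVC}(H)<k$. 2. $\mathcal G=(P\cup Q,F_0,F_1,F_2)$ is a bipartite edge-colored graph with $P=\{p_0,\dots,p_r\}$ and $Q=\{q_0,\dots,q_s\}$, where $|P|=r+1$ and $|Q|=s+1$. 3. For every $x\in U$ there are partitions $V=B_x^0\cup\dots\cup B_x^r$ and $W=C_x^0\cup\dots\cup C_x^s$ (into possibly empty sets) such that: (a) for $\tau\in\{0,1\}$ and $p_iq_j\in F_\tau$, $|E(H_x)^\tau\cap K_2[B_x^i,C_x^j]|\ge(1-\epsilon)|B_x^i||C_x^j|$;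 (b) $|B_x^i|=|C_x^j|=|W|/\ell$ for $1\le i\le r$ and $1\le j\le s$; (c) $|B_x^0|\le\epsilon|V|$ and $|C_x^0|\le\epsilon|W|$. 4. For $1\le i\le r$ and $1\le j\le s$, $|\{q\in Q:p_iq\in F_2\}|\le\epsilon|Q|$ and $|\{p\in P:pq_j\in F_2\}|\le\epsilon|P|$. Then $V$ has a partition $\mathcal P_V$ that is almost $6\mu^{1/512}$-good with respect to $H$ and satisfies $$|\mathcal P_V|\le\bigl(2c(\mu/8)^{-k}\bigr)^{\ell(2\ell)^{\ell}\epsilon^{-\ell}}.$$ -/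

import Mathlib

namespace SliceReg

/-- `t ∈ [0, ε) ∪ (1 - ε, 1]`. -/
def NearZeroOne (ε t : ℝ) : Prop :=
  t ∈ Set.Ico 0 ε ∪ Set.Ioc (1 - ε) 1

/-- The sets `B 0, …, B m` (some possibly empty) are pairwise disjoint with union `X`. -/
def IsIndexedPartition {α : Type*} [DecidableEq α] {m : ℕ} (X : Finset α)
    (B : Fin (m + 1) → Finset α) : Prop :=
  (∀ i j, i ≠ j → Disjoint (B i) (B j)) ∧ Finset.univ.biUnion B = X

section Graphs

/-- There are vertices `a i` (`i ∈ [k]`) and `b S` (`S ⊆ [k]`) such that `a i` is adjacent to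
`b S` if and only if `i ∈ S`. -/
def HasPowerSetConfig {α : Type*} (G : SimpleGraph α) (k : ℕ) : Prop :=
  ∃ (a : Fin k → α) (b : Finset (Fin k) → α), ∀ i S, G.Adj (a i) (b S) ↔ i ∈ S

/-- The VC-dimension of a graph: the largest `k` with such a configuration. -/
noncomputable def vcDim {α : Type*} (G : SimpleGraph α) : ℕ∞ :=
  ⨆ (k : ℕ) (_ : HasPowerSetConfig G k), (k : ℕ∞)

end Graphs

section ThreeGraphs

/-- A 3-uniform hypergraph with vertex set `α`. -/
structure ThreeGraph (α : Type*) where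
  edges : Set (Finset α)
  card_of_mem : ∀ e ∈ edges, e.card = 3

variable {α : Type*} [DecidableEq α]

/-- `H` is tripartite with vertex partition `U ∪ V ∪ W`. -/
def ThreeGraph.IsTripartite [Fintype α] (H : ThreeGraph α) (U V W : Finset α) : Prop :=
  Disjoint U V ∧ Disjoint U W ∧ Disjoint V W ∧ U ∪ V ∪ W = Finset.univ ∧
    ∀ e ∈ H.edges, (e ∩ U).card ≤ 1 ∧ (e ∩ V).card ≤ 1 ∧ (e ∩ W).card ≤ 1

/-- The slice graph `H_x`, on the whole vertex set of `H`. -/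
def ThreeGraph.slice (H : ThreeGraph α) (x : α) : SimpleGraph α where
  Adj y z := y ≠ z ∧ ({x, y, z} : Finset α) ∈ H.edges
  symm := ⟨fun y z h => ⟨h.1.symm, by rw [Finset.pair_comm z y]; exact h.2⟩⟩
  loopless := ⟨fun _ h => h.1 rfl⟩

/-- The slicewise VC-dimension of `H`. -/
noncomputable def ThreeGraph.svc (H : ThreeGraph α) : ℕ∞ :=
  ⨆ x : α, vcDim (H.slice x)

open Classical in
/-- `N_H(yz)`. -/
noncomputable def ThreeGraph.nbhd [Fintype α] (H : ThreeGraph α) (y z : α) : Finset α :=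
  Finset.univ.filter fun x => ({y, z, x} : Finset α) ∈ H.edges

open Classical in
/-- `X`, a subset of one part of a tripartite 3-graph `H` whose two other parts are `Y` and `Z`,
is almost `ε`-good with respect to `H`. -/
def ThreeGraph.IsAlmostGood [Fintype α] (H : ThreeGraph α) (Y Z : Finset α) (ε : ℝ)
    (X : Finset α) : Prop :=
  (1 - ε) * (Y.card : ℝ) * (Z.card : ℝ) ≤
    (((Y ×ˢ Z).filter fun p =>
      NearZeroOne ε (((H.nbhd p.1 p.2 ∩ X).card : ℝ) / (X.card : ℝ))).card : ℝ)

/-- The partition `P` of the part `X` of a tripartite 3-graph `H` whose two other parts are `Y`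
and `Z` is almost `ε`-good with respect to `H`: almost good parts cover at least
`(1 - ε) |X|` elements of `X`. -/
def ThreeGraph.IsAlmostGoodPartition [Fintype α] (H : ThreeGraph α) (Y Z : Finset α) (ε : ℝ)
    {X : Finset α} (P : Finpartition X) : Prop :=
  ∃ P' ⊆ P.parts, (1 - ε) * (X.card : ℝ) ≤ ((P'.biUnion id).card : ℝ) ∧
    ∀ S ∈ P', H.IsAlmostGood Y Z ε S

open Classical in
/-- `|E(G)^τ ∩ K₂[X, Y]|` for disjoint `X` and `Y`, where `E(G)^1 = E(G)` (for `τ = true`) and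
`E(G)^0` is the set of non-adjacent pairs of distinct vertices (for `τ = false`). -/
noncomputable def signedEdgeCount [Fintype α] (G : SimpleGraph α) (τ : Bool)
    (X Y : Finset α) : ℕ :=
  (if τ then G.interedges X Y else Gᶜ.interedges X Y).card

end ThreeGraphs

section ColoredGraphs

/-- A bipartite edge-colored graph `(A ∪ B, E₀, E₁, E₂)`: the pairs in `A × B` are partitioned
into the three classes `E_u = {(a, b) | color a b = u}`. -/
structure ColoredBipartite (A B : Type*) where
  color : A → B → Fin 3

namespace ColoredBipartite

variable {A B : Type*}

/-- The edge color `E_u`. -/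
def edgeClass [Fintype A] [Fintype B] (G : ColoredBipartite A B) (u : Fin 3) : Finset (A × B) :=
  Finset.univ.filter fun p => G.color p.1 p.2 = u

/-- `N_{E_u}(a)` for `a ∈ A`. -/
def nbhdLeft [Fintype B] (G : ColoredBipartite A B) (u : Fin 3) (a : A) : Finset B :=
  Finset.univ.filter fun b => G.color a b = u

/-- `N_{E_u}(b)` for `b ∈ B`. -/
def nbhdRight [Fintype A] (G : ColoredBipartite A B) (u : Fin 3) (b : B) : Finset A :=
  Finset.univ.filter fun a => G.color a b = u

/-- There is an `E_u/E_v`-copy of `U(k)` in `G`, with right side in `B` or with right side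
in `A`. -/
def HasCopy (G : ColoredBipartite A B) (u v : Fin 3) (k : ℕ) : Prop :=
  (∃ (x : Fin k → A) (y : Finset (Fin k) → B), ∀ i S,
      (i ∈ S → G.color (x i) (y S) = u) ∧ (i ∉ S → G.color (x i) (y S) = v)) ∨
  (∃ (x : Fin k → B) (y : Finset (Fin k) → A), ∀ i S,
      (i ∈ S → G.color (y S) (x i) = u) ∧ (i ∉ S → G.color (y S) (x i) = v))

/-- `(P, Q)` is `ε`-homogeneous for `G` with respect to `{E₀, E₁}`. -/
def IsHomogeneous [Fintype A] [Fintype B] [DecidableEq A] [DecidableEq B]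
    (G : ColoredBipartite A B) (ε : ℝ) (P : Finpartition (Finset.univ : Finset A))
    (Q : Finpartition (Finset.univ : Finset B)) : Prop :=
  ∃ S₀ ⊆ P.parts ×ˢ Q.parts, ∃ S₁ ⊆ P.parts ×ˢ Q.parts,
    (1 - ε) * (Fintype.card A : ℝ) * (Fintype.card B : ℝ) ≤
      (((S₀ ∪ S₁).biUnion fun p => p.1 ×ˢ p.2).card : ℝ) ∧
    (∀ p ∈ S₀, (1 - ε) * (p.1.card : ℝ) * (p.2.card : ℝ) ≤
      ((G.edgeClass 0 ∩ p.1 ×ˢ p.2).card : ℝ)) ∧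
    (∀ p ∈ S₁, (1 - ε) * (p.1.card : ℝ) * (p.2.card : ℝ) ≤
      ((G.edgeClass 1 ∩ p.1 ×ˢ p.2).card : ℝ))

end ColoredBipartite

/-- `c` is a constant for `k` in the structure theorem for bipartite edge-colored graphs with few
edges of color `E₂` and without `E₀/E₁`-copies of `U(k)`. -/
def IsRemovalConstant (k : ℕ) (c : ℝ) : Prop :=
  0 < c ∧
  ∀ ε δ : ℝ, 0 < ε → ε < 1 / 2 → 0 < δ → δ < 1 / 2 →
    ε ≤ (c ^ 4)⁻¹ * (δ / 8) ^ (4 * k + 4) / 8 →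
  ∀ (A B : Type) [Fintype A] [Fintype B] [DecidableEq A] [DecidableEq B]
    (G : ColoredBipartite A B),
    ((G.edgeClass 2).card : ℝ) ≤ ε * (Fintype.card A : ℝ) * (Fintype.card B : ℝ) →
    ¬ G.HasCopy 0 1 k →
    ∃ (P : Finpartition (Finset.univ : Finset A)) (Q : Finpartition (Finset.univ : Finset B)),
      G.IsHomogeneous (2 * δ ^ (1 / 16 : ℝ)) P Q ∧
      (P.parts.card : ℝ) ≤ 2 * c * ((δ / 8) ^ k)⁻¹ ∧
      (Q.parts.card : ℝ) ≤ 2 * c * ((δ / 8) ^ k)⁻¹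

end ColoredGraphs

/-- `μ = 8 (16 ε^{1/16} c⁴)^{1/(4k+4)}`. -/
noncomputable def muParam (k : ℕ) (c ε : ℝ) : ℝ :=
  8 * (16 * ε ^ (1 / 16 : ℝ) * c ^ 4) ^ (1 / (4 * (k : ℝ) + 4))

/-- The edge-colored graph `𝒢` with vertex classes `p_0, …, p_r` and `q_0, …, q_s` is a reduced
graph of the slice graph `H_x` through partitions `B^0 ∪ … ∪ B^r` of `V` and `C^0 ∪ … ∪ C^s`
of `W`, where `B^0` and `C^0` are exceptional and the other sets all have size `|W| / ℓ`. -/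
def IsReducedSlice {α : Type*} [Fintype α] [DecidableEq α] (H : ThreeGraph α) (V W : Finset α)
    (ℓ : ℕ) (ε : ℝ) {r s : ℕ} (𝒢 : ColoredBipartite (Fin (r + 1)) (Fin (s + 1))) (x : α) :
    Prop :=
  ∃ (B : Fin (r + 1) → Finset α) (C : Fin (s + 1) → Finset α),
    IsIndexedPartition V B ∧ IsIndexedPartition W C ∧
    (∀ i j, 𝒢.color i j = 0 →
      (1 - ε) * ((B i).card : ℝ) * ((C j).card : ℝ) ≤
        (signedEdgeCount (H.slice x) false (B i) (C j) : ℝ)) ∧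
    (∀ i j, 𝒢.color i j = 1 →
      (1 - ε) * ((B i).card : ℝ) * ((C j).card : ℝ) ≤
        (signedEdgeCount (H.slice x) true (B i) (C j) : ℝ)) ∧
    (∀ i, i ≠ 0 → ((B i).card : ℝ) = (W.card : ℝ) / (ℓ : ℝ)) ∧
    (∀ j, j ≠ 0 → ((C j).card : ℝ) = (W.card : ℝ) / (ℓ : ℝ)) ∧
    ((B 0).card : ℝ) ≤ ε * (V.card : ℝ) ∧ ((C 0).card : ℝ) ≤ ε * (W.card : ℝ)

end SliceReg

open SliceReg

namespace SliceReg

open Finset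
open scoped Classical

/-!
Since the slices `H_z` have bounded VC-dimension, the neighbourhoods of the vertices `y ∈ V` in
`H_z` fall into boundedly many clusters of small diameter: by Sauer–Shelah applied to a random
sample, few of them are pairwise far apart. Through a reduced slice `H_x`, every `z ∈ W` outside a
small exceptional set agrees on `V` with a proportion about `1 / (2ℓ)` of `W`, so a bounded random
set `T ⊆ W` contains such a twin `z'` of `z` for almost all pairs `(x, z)`. Hence whether `xyz` is
an edge is predicted, up to a small error, by `x`, `z` and the cluster of `y` in `H_z'`, and the
common refinement of the clusterings for `z' ∈ T` is almost good.

The same packing bound gives removal constants: if `G` has no `E₀/E₁`-copy of `U(k)`, its rows and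
its columns form few clusters, and a pair of clusters containing many edges of both colors would
force many disagreements inside one of the two clusters.
-/

section Packing

variable {α β ι : Type*}

/-- The points of `T` at which the rows `R a` and `R a'` of the relation `R` differ. -/
noncomputable def disagreement (R : α → β → Prop) (T : Finset β) (a a' : α) : Finset β :=
  {b ∈ T | ¬ (R a b ↔ R a' b)}

/-- Some `k` points of `T` are shattered by the rows `R a` with `a ∈ S`. -/
def HasShatteredSet (R : α → β → Prop) (S : Finset α) (T : Finset β) (k : ℕ) : Prop :=
  ∃ (x : Fin k → β) (y : Finset (Fin k) → α),
    (∀ i, x i ∈ T) ∧ (∀ s, y s ∈ S) ∧ ∀ i s, R (y s) (x i) ↔ i ∈ s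

variable {R : α → β → Prop} {S S' : Finset α} {T T' : Finset β} {k : ℕ}

theorem mem_disagreement {a a' : α} {b : β} :
    b ∈ disagreement R T a a' ↔ b ∈ T ∧ ¬ (R a b ↔ R a' b) :=
  mem_filter

theorem disagreement_subset (R : α → β → Prop) (T : Finset β) (a a' : α) :
    disagreement R T a a' ⊆ T :=
  filter_subset _ _

theorem disagreement_self (R : α → β → Prop) (T : Finset β) (a : α) :
    disagreement R T a a = ∅ := by
  simp [disagreement]

theorem disagreement_comm (R : α → β → Prop) (T : Finset β) (a a' : α) :
    disagreement R T a a' = disagreement R T a' a := by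
  simp only [disagreement, iff_comm]

theorem card_disagreement_triangle (R : α → β → Prop) (T : Finset β) (a a' a'' : α) :
    #(disagreement R T a a'') ≤ #(disagreement R T a a') + #(disagreement R T a' a'') := by
  refine (card_le_card fun b hb => ?_).trans (card_union_le _ _)
  simp only [mem_union, mem_disagreement] at hb ⊢
  tauto

theorem HasShatteredSet.mono (h : HasShatteredSet R S T k) (hS : S ⊆ S') (hT : T ⊆ T') :
    HasShatteredSet R S' T' k :=
  let ⟨x, y, hx, hy, hxy⟩ := h
  ⟨x, y, fun i => hT (hx i), fun s => hS (hy s), hxy⟩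

theorem hasShatteredSet_of_shatters {s : Finset β}
    (hs : (S.image fun a => {b ∈ T | R a b}).Shatters s) : HasShatteredSet R S T #s := by
  have hsT : s ⊆ T := by
    obtain ⟨u, hu, hsu⟩ := hs.exists_superset
    obtain ⟨a, -, rfl⟩ := mem_image.1 hu
    exact hsu.trans (filter_subset _ _)
  let e : Fin #s ↪ β := s.equivFin.symm.toEmbedding.trans (Function.Embedding.subtype _)
  have he (i : Fin #s) : e i ∈ s := (s.equivFin.symm i).2
  have row (u : Finset (Fin #s)) : ∃ a ∈ S, ∀ i, R a (e i) ↔ i ∈ u := by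
    have hu : u.map e ⊆ s := fun b hb => by
      obtain ⟨i, -, rfl⟩ := mem_map.1 hb
      exact he i
    obtain ⟨v, hv, hvu⟩ := hs hu
    obtain ⟨a, ha, rfl⟩ := mem_image.1 hv
    refine ⟨a, ha, fun i => ?_⟩
    rw [← mem_map' e, ← hvu]
    simp [he i, hsT (he i)]
  choose y hyS hy using row
  exact ⟨e, y, fun i => hsT (he i), hyS, fun i u => hy u i⟩

theorem card_filter_powerset_card_lt_le (T : Finset β) (k : ℕ) :
    #{s ∈ T.powerset | #s < k} ≤ (#T + 1) ^ k := by
  have hcover : {s ∈ T.powerset | #s < k} ⊆ (range k).biUnion fun i => T.powersetCard i := by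
    intro s hs
    simp only [mem_filter, mem_powerset] at hs
    simp only [mem_biUnion, mem_range, mem_powersetCard]
    exact ⟨#s, hs.2, hs.1, rfl⟩
  calc #{s ∈ T.powerset | #s < k}
    _ ≤ ∑ i ∈ range k, #(T.powersetCard i) := (card_le_card hcover).trans card_biUnion_le
    _ ≤ ∑ i ∈ range k, #T ^ i * k.choose i := by
        refine sum_le_sum fun i hi => ?_
        rw [card_powersetCard]
        exact (Nat.choose_le_pow _ _).trans
          (Nat.le_mul_of_pos_right _ (Nat.choose_pos (mem_range.1 hi).le))
    _ ≤ ∑ i ∈ range (k + 1), #T ^ i * k.choose i :=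
        sum_le_sum_of_subset (range_mono k.le_succ)
    _ = (#T + 1) ^ k := by simp [add_pow]

theorem card_le_of_distinguished (hR : ¬ HasShatteredSet R S T k)
    (hsep : (S : Set α).Pairwise fun a a' => (disagreement R T a a').Nonempty) :
    #S ≤ (#T + 1) ^ k := by
  have hinj : Set.InjOn (fun a => {b ∈ T | R a b}) S := by
    intro a ha a' ha' h
    by_contra hne
    obtain ⟨b, hb⟩ := hsep ha ha' hne
    rw [mem_disagreement] at hb
    have := Finset.ext_iff.1 h b
    simp only [mem_filter, hb.1, true_and] at this
    exact hb.2 this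
  rw [← card_image_of_injOn hinj]
  refine (card_le_card_shatterer _).trans
    ((card_le_card fun s hs => ?_).trans (card_filter_powerset_card_lt_le T k))
  have hshat := mem_shatterer.1 hs
  obtain ⟨u, hu, hsu⟩ := hshat.exists_superset
  obtain ⟨a, -, rfl⟩ := mem_image.1 hu
  refine mem_filter.2 ⟨mem_powerset.2 (hsu.trans (filter_subset _ _)),
    lt_of_not_ge fun hks => hR ?_⟩
  obtain ⟨s', hs', rfl⟩ := exists_subset_card_eq hks
  exact hasShatteredSet_of_shatters (hshat.mono_right hs')

theorem exists_hitting_set (hT : T.Nonempty) (I : Finset ι) (r : ι → β → Prop)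
    [∀ i, DecidablePred (r i)] {q : ℝ}
    (hq : q ≤ 1) (hr : ∀ i ∈ I, q * #T ≤ #{b ∈ T | r i b}) (t : ℕ) :
    ∃ T' ⊆ T, #T' ≤ t ∧ (#{i ∈ I | ∀ b ∈ T', ¬ r i b} : ℝ) ≤ (1 - q) ^ t * #I := by
  induction t with
  | zero => exact ⟨∅, by simp⟩
  | succ t ih =>
    obtain ⟨T', hT', hcard, hmiss⟩ := ih
    set J := {i ∈ I | ∀ b ∈ T', ¬ r i b}
    have hsum : ∑ _b ∈ T, q * (#J : ℝ) ≤ ∑ b ∈ T, (#{i ∈ J | r i b} : ℝ) := by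
      have hcount := sum_card_bipartiteAbove_eq_sum_card_bipartiteBelow (s := J) (t := T) r
      calc ∑ _b ∈ T, q * (#J : ℝ) = ∑ _i ∈ J, q * #T := by
            simp only [sum_const, nsmul_eq_mul]; ring
        _ ≤ ∑ i ∈ J, (#{b ∈ T | r i b} : ℝ) := sum_le_sum fun i hi => hr i (mem_filter.1 hi).1
        _ = ∑ b ∈ T, (#{i ∈ J | r i b} : ℝ) := mod_cast hcount
    obtain ⟨b, hb, hbJ⟩ := exists_le_of_sum_le hT hsum
    have hsplit : (#{i ∈ J | r i b} : ℝ) + #{i ∈ J | ¬ r i b} = #J :=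
      mod_cast card_filter_add_card_filter_not (s := J) fun i => r i b
    have hrest : {i ∈ I | ∀ v ∈ insert b T', ¬ r i v} = {i ∈ J | ¬ r i b} := by
      simp only [J, filter_filter, forall_mem_insert, and_comm]
    refine ⟨insert b T', insert_subset hb hT', (card_insert_le _ _).trans (by lia), ?_⟩
    calc (#{i ∈ I | ∀ v ∈ insert b T', ¬ r i v} : ℝ) ≤ (1 - q) * #J := by rw [hrest]; linarith
      _ ≤ (1 - q) * ((1 - q) ^ t * #I) := mul_le_mul_of_nonneg_left hmiss (sub_nonneg.2 hq)
      _ = (1 - q) ^ (t + 1) * #I := by ring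

theorem exists_distinguishing_set (hT : T.Nonempty) {q : ℝ} (hq : q ≤ 1)
    (hsep : (S : Set α).Pairwise fun a a' => q * #T < #(disagreement R T a a')) {t : ℕ}
    (ht : (#S : ℝ) ^ 2 * (1 - q) ^ t < 1) :
    ∃ T' ⊆ T, #T' ≤ t ∧ (S : Set α).Pairwise fun a a' => (disagreement R T' a a').Nonempty := by
  obtain ⟨T', hT', hcard, hmiss⟩ := exists_hitting_set hT S.offDiag
    (fun p b => b ∈ disagreement R T p.1 p.2) hq (fun p hp => by
      obtain ⟨h₁, h₂, hne⟩ := mem_offDiag.1 hp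
      rw [filter_mem_eq_inter, inter_eq_right.2 (disagreement_subset R T _ _)]
      exact (hsep h₁ h₂ hne).le) t
  have hoff : (#S.offDiag : ℝ) ≤ (#S : ℝ) ^ 2 := by
    rw [sq, offDiag_card]
    exact_mod_cast Nat.sub_le _ _
  have hone : (1 - q) ^ t * #S.offDiag < 1 := by
    refine lt_of_le_of_lt ?_ ht
    rw [mul_comm]
    exact mul_le_mul_of_nonneg_right hoff (pow_nonneg (sub_nonneg.2 hq) t)
  have hnone := filter_eq_empty_iff.1 <| card_eq_zero.1 <| Nat.lt_one_iff.1 <| by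
    exact_mod_cast hmiss.trans_lt hone
  refine ⟨T', hT', hcard, fun a ha a' ha' hne => ?_⟩
  have hpair := hnone (x := (a, a')) (mem_offDiag.2 ⟨ha, ha', hne⟩)
  push Not at hpair
  obtain ⟨b, hb, hb'⟩ := hpair
  exact ⟨b, mem_disagreement.2 ⟨hb, (mem_disagreement.1 hb').2⟩⟩

theorem one_sub_pow_le_exp {q : ℝ} (hq : q ≤ 1) (t : ℕ) : (1 - q) ^ t ≤ Real.exp (-(q * t)) := by
  calc (1 - q) ^ t ≤ Real.exp (-q) ^ t :=
        pow_le_pow_left₀ (sub_nonneg.2 hq) (Real.one_sub_le_exp_neg q) t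
    _ = Real.exp (-(q * t)) := by rw [← Real.exp_nat_mul]; ring_nf

theorem exists_sample_size (k : ℕ) {q : ℝ} (hq : 0 < q) (hq1 : q ≤ 1) :
    ∃ t : ℕ, (t : ℝ) + 1 ≤ 18 * ((k : ℝ) + 1) ^ 2 / q ^ 2 ∧
      (((t : ℝ) + 1) ^ k + 1) ^ 2 * (1 - q) ^ t < 1 := by
  set y : ℝ := 4 * (k + 1)
  have : (1 : ℝ) ≤ k + 1 := by simp
  set t := ⌈y ^ 2 / q ^ 2⌉₊
  have hyt : y ^ 2 / q ^ 2 ≤ t := Nat.le_ceil _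
  refine ⟨t, ?_, ?_⟩
  · have ht := Nat.ceil_lt_add_one (show 0 ≤ y ^ 2 / q ^ 2 by positivity)
    have htwo : 2 ≤ 2 * ((k : ℝ) + 1) ^ 2 / q ^ 2 := by
      rw [le_div_iff₀ (by positivity)]; nlinarith
    have hsplit : 18 * ((k : ℝ) + 1) ^ 2 / q ^ 2 =
        y ^ 2 / q ^ 2 + 2 * ((k : ℝ) + 1) ^ 2 / q ^ 2 := by ring
    linarith
  set x := √t
  have hx : 0 ≤ x := Real.sqrt_nonneg _
  have hxt : x ^ 2 = t := Real.sq_sqrt t.cast_nonneg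
  have hyx : y ≤ q * x := by
    rw [← div_le_iff₀' hq]
    exact Real.le_sqrt_of_sq_le (by rwa [div_pow])
  have hx1 : 1 ≤ x := by nlinarith
  have hpoly : (((t : ℝ) + 1) ^ k + 1) ^ 2 < (x + 1) ^ (4 * (k + 1)) := by
    have hone : 1 ≤ ((t : ℝ) + 1) ^ k := one_le_pow₀ (by simp)
    calc (((t : ℝ) + 1) ^ k + 1) ^ 2 ≤ ((t + 1) ^ (k + 1)) ^ 2 := by
          gcongr; rw [pow_succ]; nlinarith
      _ = (x ^ 2 + 1) ^ (2 * (k + 1)) := by rw [hxt]; ring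
      _ < ((x + 1) ^ 2) ^ (2 * (k + 1)) := by
          gcongr ?_ ^ _; nlinarith
      _ = (x + 1) ^ (4 * (k + 1)) := by rw [← pow_mul]; ring_nf
  have hexp : (x + 1) ^ (4 * (k + 1)) ≤ Real.exp (q * t) := by
    calc (x + 1) ^ (4 * (k + 1)) ≤ Real.exp x ^ (4 * (k + 1)) := by
          gcongr; exact Real.add_one_le_exp x
      _ = Real.exp (y * x) := by rw [← Real.exp_nat_mul]; push_cast; rfl
      _ ≤ Real.exp (q * t) := by
          rw [← hxt, Real.exp_le_exp]; nlinarith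
  calc _ ≤ (((t : ℝ) + 1) ^ k + 1) ^ 2 * Real.exp (-(q * t)) := by
        gcongr; exact one_sub_pow_le_exp hq1 t
    _ < Real.exp (q * t) * Real.exp (-(q * t)) := by gcongr; exact hpoly.trans_le hexp
    _ = 1 := by rw [← Real.exp_add, add_neg_cancel, Real.exp_zero]

/-- An upper bound for the number of rows of a relation which shatters no `k` points, if any two
of these rows differ in more than a proportion `q` of the points. -/
noncomputable def packingBound (k : ℕ) (q : ℝ) : ℕ :=
  ⌊(18 * ((k : ℝ) + 1) ^ 2 / q ^ 2) ^ k⌋₊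

theorem card_le_packingBound (hR : ¬ HasShatteredSet R S T k) {q : ℝ} (hq : 0 < q) (hq1 : q ≤ 1)
    (hsep : (S : Set α).Pairwise fun a a' => q * #T < #(disagreement R T a a')) :
    #S ≤ packingBound k q := by
  obtain ⟨t, ht, hsmall⟩ := exists_sample_size k hq hq1
  suffices #S ≤ (t + 1) ^ k by
    refine Nat.le_floor ?_
    calc (#S : ℝ) ≤ ((t : ℝ) + 1) ^ k := mod_cast this
      _ ≤ (18 * ((k : ℝ) + 1) ^ 2 / q ^ 2) ^ k := by gcongr
  obtain rfl | hT := T.eq_empty_or_nonempty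
  · have hone : #S ≤ 1 := card_le_one.2 fun a ha a' ha' => by
      by_contra hne
      simpa [disagreement] using hsep ha ha' hne
    exact hone.trans (Nat.one_le_pow _ _ t.succ_pos)
  by_contra! hlt
  obtain ⟨S', hS', hcard⟩ := exists_subset_card_eq (Nat.succ_le_of_lt hlt)
  obtain ⟨T', hT', hT't, hdist⟩ := exists_distinguishing_set hT hq1 (hsep.mono (coe_subset.2 hS'))
    (by rw [hcard]; exact_mod_cast hsmall)
  have hle := card_le_of_distinguished (fun h => hR (h.mono hS' hT')) hdist
  have hpow : (#T' + 1) ^ k ≤ (t + 1) ^ k := by gcongr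
  lia

theorem exists_cover_of_card_le {r : α → α → Prop} (hrefl : ∀ a, r a a)
    (hsymm : ∀ a a', r a a' → r a' a) {X : Finset α} {M : ℕ}
    (hM : ∀ S ⊆ X, (S : Set α).Pairwise (fun a a' => ¬ r a a') → #S ≤ M) :
    ∃ f : α → Fin (M + 1), ∀ a ∈ X, ∀ a' ∈ X, f a = f a' → ∃ s, r a s ∧ r s a' := by
  obtain ⟨S, hS, hmax⟩ := exists_max_image
    (X.powerset.filter fun S : Finset α => (S : Set α).Pairwise fun a a' => ¬ r a a') card
    ⟨∅, by simp⟩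
  simp only [mem_filter, mem_powerset] at hS hmax
  have hcover (a : α) : ∃ s, a ∈ X → s ∈ S ∧ r a s := by
    by_contra! hfar
    have ha : a ∉ S := fun ha => (hfar a).2 ha (hrefl a)
    have hle := hmax (insert a S) ⟨insert_subset (hfar a).1 hS.1, by
      rw [coe_insert, Set.pairwise_insert]
      exact ⟨hS.2, fun s hs _ => ⟨(hfar s).2 hs, fun h => (hfar s).2 hs (hsymm _ _ h)⟩⟩⟩
    rw [card_insert_of_notMem ha] at hle
    lia
  choose c hc using hcover
  have hSM : #S ≤ M + 1 := (hM S hS.1 hS.2).trans M.le_succ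
  refine ⟨fun a => if h : c a ∈ S then (S.equivFin ⟨c a, h⟩).castLE hSM else Fin.last M,
    fun a ha a' ha' h => ⟨c a, (hc a ha).2, hsymm _ _ ?_⟩⟩
  simp only [dif_pos (hc a ha).1, dif_pos (hc a' ha').1, Fin.castLE_inj,
    EmbeddingLike.apply_eq_iff_eq, Subtype.mk.injEq] at h
  exact h ▸ (hc a' ha').2

theorem exists_clustering {X : Finset α} {d : ℝ} (hd : 0 ≤ d) {M : ℕ}
    (hM : ∀ S ⊆ X, (S : Set α).Pairwise (fun a a' => d < #(disagreement R T a a')) → #S ≤ M) :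
    ∃ f : α → Fin (M + 1), ∀ a ∈ X, ∀ a' ∈ X, f a = f a' →
      (#(disagreement R T a a') : ℝ) ≤ 2 * d := by
  obtain ⟨f, hf⟩ := exists_cover_of_card_le (r := fun a a' => (#(disagreement R T a a') : ℝ) ≤ d)
    (fun a => by simpa [disagreement_self] using hd) (fun a a' h => by rwa [disagreement_comm])
    (by simpa only [not_le] using hM)
  refine ⟨f, fun a ha a' ha' h => ?_⟩
  obtain ⟨s, has, hsa'⟩ := hf a ha a' ha' h
  have htri : (#(disagreement R T a a') : ℝ) ≤
      #(disagreement R T a s) + #(disagreement R T s a') :=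
    mod_cast card_disagreement_triangle R T a s a'
  linarith

end Packing

section Partitions

variable {α ι : Type*} [DecidableEq α]

theorem mul_sum_filter_le_sum {s : Finset ι} {v w : ι → ℝ} {p : ι → Prop} [DecidablePred p] {c : ℝ}
    (hw : ∀ i ∈ s, 0 ≤ w i) (hp : ∀ i ∈ s, p i → c * v i ≤ w i) :
    c * ∑ i ∈ s with p i, v i ≤ ∑ i ∈ s, w i := by
  rw [mul_sum]
  calc ∑ i ∈ s with p i, c * v i ≤ ∑ i ∈ s with p i, w i :=
        sum_le_sum fun i hi => hp i (mem_filter.1 hi).1 (mem_filter.1 hi).2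
    _ ≤ ∑ i ∈ s, w i := sum_le_sum_of_subset_of_nonneg (filter_subset _ _) fun i hi _ => hw i hi

theorem sum_parts {M : Type*} [AddCommMonoid M] {X : Finset α} (P : Finpartition X) (h : α → M) :
    ∑ Y ∈ P.parts, ∑ y ∈ Y, h y = ∑ x ∈ X, h x := by
  conv_rhs => rw [← P.biUnion_parts]
  exact (sum_biUnion P.supIndep.pairwiseDisjoint).symm

theorem sum_card_filter_parts {X : Finset α} (P : Finpartition X) (p : α → Prop)
    [DecidablePred p] :
    ∑ Y ∈ P.parts, #{y ∈ Y | p y} = #{x ∈ X | p x} := by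
  simp only [card_filter]
  exact sum_parts P _

/-- The partition of `X` into the fibers of `f`. -/
noncomputable def fiberPartition (X : Finset α) (f : α → ι) : Finpartition X :=
  Finpartition.ofSetSetoid (Setoid.ker f) X

theorem parts_fiberPartition (X : Finset α) (f : α → ι) :
    (fiberPartition X f).parts = (X.image f).image fun i => {x ∈ X | i = f x} := by
  rw [image_image]
  rfl

theorem eq_of_mem_fiberPartition {X : Finset α} {f : α → ι} {Y : Finset α}
    (hY : Y ∈ (fiberPartition X f).parts) {a a' : α} (ha : a ∈ Y) (ha' : a' ∈ Y) : f a = f a' := by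
  rw [parts_fiberPartition] at hY
  obtain ⟨i, -, rfl⟩ := mem_image.1 hY
  exact (mem_filter.1 ha).2.symm.trans (mem_filter.1 ha').2

theorem card_fiberPartition_le [Fintype ι] (X : Finset α) (f : α → ι) :
    #(fiberPartition X f).parts ≤ Fintype.card ι := by
  rw [parts_fiberPartition]
  exact card_image_le.trans (card_le_univ _)

end Partitions

section Deviation

variable {A B : Type*}

/-- The average over `a ∈ X` of the total disagreement on `Y` of the row of `a` with the rows
of `X`; it controls how far the relation is from being constant on `X ×ˢ Y`. -/
noncomputable def deviation (R : A → B → Prop) (X : Finset A) (Y : Finset B) : ℝ :=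
  (∑ a ∈ X, ∑ a' ∈ X, (#(disagreement R Y a a') : ℝ)) / #X

theorem deviation_nonneg (R : A → B → Prop) (X : Finset A) (Y : Finset B) :
    0 ≤ deviation R X Y := by
  unfold deviation
  positivity

theorem card_mul_deviation (R : A → B → Prop) (X : Finset A) (Y : Finset B) :
    #X * deviation R X Y = ∑ a ∈ X, ∑ a' ∈ X, (#(disagreement R Y a a') : ℝ) := by
  obtain rfl | hX := X.eq_empty_or_nonempty
  · simp
  · exact mul_div_cancel₀ _ (by simpa using hX.ne_empty)

theorem sum_deviation_parts [DecidableEq B] (R : A → B → Prop) (X : Finset A) {T : Finset B}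
    (Q : Finpartition T) : ∑ Y ∈ Q.parts, deviation R X Y = deviation R X T := by
  simp only [deviation]
  rw [← sum_div, sum_comm]
  congr 1
  refine sum_congr rfl fun a _ => ?_
  rw [sum_comm]
  exact sum_congr rfl fun a' _ => by
    exact_mod_cast sum_card_filter_parts Q fun b => ¬ (R a b ↔ R a' b)

theorem deviation_le_two_mul_sum {R : A → B → Prop} {X : Finset A} {T : Finset B} {w : A → ℝ}
    (hw : ∀ a ∈ X, ∀ a' ∈ X, #(disagreement R T a a') ≤ w a + w a') :
    deviation R X T ≤ 2 * ∑ a ∈ X, w a := by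
  obtain rfl | hX := X.eq_empty_or_nonempty
  · simp [deviation]
  rw [deviation, div_le_iff₀ (by simpa using hX)]
  calc ∑ a ∈ X, ∑ a' ∈ X, (#(disagreement R T a a') : ℝ)
    _ ≤ ∑ a ∈ X, ∑ a' ∈ X, (w a + w a') :=
        sum_le_sum fun a ha => sum_le_sum fun a' ha' => hw a ha a' ha'
    _ = 2 * (∑ a ∈ X, w a) * #X := by
        simp only [sum_add_distrib, sum_const, nsmul_eq_mul, ← mul_sum]
        ring

/-- If `R a b` holds and `R a' b'` fails, then `R a' b` differs from one of them. -/
theorem card_interedges_mul_card_interedges_not_le (R : A → B → Prop)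
    [∀ a, DecidablePred (R a)] (X : Finset A) (Y : Finset B) :
    (#(Rel.interedges R X Y) : ℝ) * #(Rel.interedges (fun a b => ¬ R a b) X Y) ≤
      #X * #Y * (deviation R X Y + deviation (fun b a => R a b) Y X) := by
  calc (#(Rel.interedges R X Y) : ℝ) * #(Rel.interedges (fun a b => ¬ R a b) X Y)
    _ = ∑ a ∈ X, ∑ b ∈ Y, ∑ a' ∈ X, ∑ b' ∈ Y,
          (if R a b then (1 : ℝ) else 0) * if ¬ R a' b' then 1 else 0 := by
        simp only [Rel.interedges, card_filter, Nat.cast_sum, Nat.cast_ite, Nat.cast_one,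
          Nat.cast_zero, sum_mul_sum, sum_product]
        exact sum_congr rfl fun a _ => sum_comm
    _ ≤ ∑ a ∈ X, ∑ b ∈ Y, ∑ a' ∈ X, ∑ b' ∈ Y,
          ((if ¬ (R a b ↔ R a' b) then (1 : ℝ) else 0) +
            if ¬ (R a' b ↔ R a' b') then 1 else 0) := by
        refine sum_le_sum fun a _ => sum_le_sum fun b _ => sum_le_sum fun a' _ =>
          sum_le_sum fun b' _ => ?_
        by_cases h₁ : R a b <;> by_cases h₂ : R a' b' <;> by_cases h₃ : R a' b <;>
          simp [h₁, h₂, h₃]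
    _ = #Y * (∑ a ∈ X, ∑ a' ∈ X, (#(disagreement R Y a a') : ℝ)) +
          #X * ∑ b ∈ Y, ∑ b' ∈ Y, (#(disagreement (fun b a => R a b) X b b') : ℝ) := by
        simp only [disagreement, card_filter, Nat.cast_sum, Nat.cast_ite, Nat.cast_one,
          Nat.cast_zero, sum_add_distrib, sum_const, nsmul_eq_mul, mul_sum]
        congr 1
        · exact sum_congr rfl fun a _ => sum_comm
        · exact sum_congr rfl fun b _ => sum_comm
    _ = #X * #Y * (deviation R X Y + deviation (fun b a => R a b) Y X) := by
        rw [← card_mul_deviation, ← card_mul_deviation]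
        ring

end Deviation

namespace ColoredBipartite

variable {A B : Type*} [Fintype A] [Fintype B] [DecidableEq A] [DecidableEq B]

/-- A pair of sets almost all of whose pairs have color `u`. -/
def IsHomogeneousCell (G : ColoredBipartite A B) (η : ℝ) (u : Fin 3) (X : Finset A)
    (Y : Finset B) : Prop :=
  (1 - η) * #X * #Y ≤ #(G.edgeClass u ∩ X ×ˢ Y)

theorem card_edgeClass_inter_add (G : ColoredBipartite A B) (X : Finset A) (Y : Finset B) :
    #(G.edgeClass 0 ∩ X ×ˢ Y) + #(G.edgeClass 1 ∩ X ×ˢ Y) + #(G.edgeClass 2 ∩ X ×ˢ Y) =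
      #X * #Y := by
  have hfib := card_eq_sum_card_fiberwise (s := X ×ˢ Y) (f := fun p : A × B => G.color p.1 p.2)
    (t := univ) (by simp)
  simp only [edgeClass, filter_inter, univ_inter]
  rw [← card_product, hfib, Fin.sum_univ_three]

theorem mul_card_le_of_not_isHomogeneousCell {G : ColoredBipartite A B} {η : ℝ} {X : Finset A}
    {Y : Finset B} (h₀ : ¬ G.IsHomogeneousCell η 0 X Y) (h₁ : ¬ G.IsHomogeneousCell η 1 X Y) :
    η * (#X * #Y) ≤ 2 * #(G.edgeClass 2 ∩ X ×ˢ Y) +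
      4 * (deviation (fun a b => G.color a b = 0) X Y +
        deviation (fun b a => G.color a b = 0) Y X) := by
  set D := deviation (fun a b => G.color a b = 0) X Y + deviation (fun b a => G.color a b = 0) Y X
  have hD : 0 ≤ D := add_nonneg (deviation_nonneg _ _ _) (deviation_nonneg _ _ _)
  set N : ℝ := #X * #Y with hN
  set n : Fin 3 → ℝ := fun u => #(G.edgeClass u ∩ X ×ˢ Y)
  have hsum : n 0 + n 1 + n 2 = N := by
    simp only [n, N]
    exact_mod_cast G.card_edgeClass_inter_add X Y
  have hn (u : Fin 3) : 0 ≤ n u := Nat.cast_nonneg _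
  have hprod : n 0 * (n 1 + n 2) ≤ N * D := by
    have hinter : Rel.interedges (fun a b => G.color a b = 0) X Y = G.edgeClass 0 ∩ X ×ˢ Y := by
      rw [edgeClass, filter_inter, univ_inter, Rel.interedges]
    have hcompl : (#(Rel.interedges (fun a b => G.color a b = 0) X Y) : ℝ) +
        #(Rel.interedges (fun a b => ¬ G.color a b = 0) X Y) = N := by
      rw [hN]
      exact_mod_cast Rel.card_interedges_add_card_interedges_compl
        (fun a b => G.color a b = 0) X Y
    have hle := card_interedges_mul_card_interedges_not_le (fun a b => G.color a b = 0) X Y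
    rw [eq_sub_of_add_eq' hcompl, hinter] at hle
    calc n 0 * (n 1 + n 2) = n 0 * (N - n 0) := by rw [← hsum]; ring
      _ ≤ N * D := hle
  simp only [IsHomogeneousCell, not_le, mul_assoc] at h₀ h₁
  change n 0 < (1 - η) * N at h₀
  change n 1 < (1 - η) * N at h₁
  obtain h₂ | h₂ := le_total (η * N / 2) (n 2)
  · linarith
  · have hNpos : 0 < N := by nlinarith [hn 0, hn 1, hn 2]
    suffices N * (η * N) ≤ N * (4 * D) by linarith [le_of_mul_le_mul_left this hNpos, hn 2]
    have h₀' : η * N / 2 < n 0 := by linarith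
    have h₁' : η * N < n 1 + n 2 := by linarith
    calc N * (η * N) ≤ 4 * (n 0 * (n 1 + n 2)) := by
          obtain h | h := le_total (N / 2) (n 0)
          · nlinarith [mul_le_mul_of_nonneg_right h (add_nonneg (hn 1) (hn 2)),
              mul_lt_mul_of_pos_left h₁' hNpos]
          · have h' : N / 2 ≤ n 1 + n 2 := by linarith
            nlinarith [mul_le_mul_of_nonneg_left h' (hn 0), mul_lt_mul_of_pos_left h₀' hNpos]
      _ ≤ N * (4 * D) := by linarith

end ColoredBipartite

namespace ColoredBipartite

variable {A B : Type*}

/-- The same coloring with the two sides exchanged. -/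
def swap (G : ColoredBipartite A B) : ColoredBipartite B A :=
  ⟨fun b a => G.color a b⟩

theorem hasCopy_swap {G : ColoredBipartite A B} {u v : Fin 3} {k : ℕ} :
    G.swap.HasCopy u v k ↔ G.HasCopy u v k :=
  or_comm

variable [Fintype B]

theorem card_le_packingBound_of_not_hasCopy {G : ColoredBipartite A B} {k : ℕ}
    (hG : ¬ G.HasCopy 0 1 k) {q ρ : ℝ} (hq : 0 < q) (hq1 : q ≤ 1)
    (hρ : (packingBound k (q / 2) + 1) * ρ ≤ q / 2) {S : Finset A}
    (hS : ∀ a ∈ S, #(G.nbhdLeft 2 a) ≤ ρ * Fintype.card B)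
    (hsep : (S : Set A).Pairwise fun a a' =>
      q * Fintype.card B < #(disagreement (fun a b => G.color a b = 0) univ a a')) :
    #S ≤ packingBound k (q / 2) := by
  by_contra! hlt
  obtain ⟨S', hS', hcard⟩ := exists_subset_card_eq (Nat.succ_le_of_lt hlt)
  set bad := S'.biUnion (G.nbhdLeft 2)
  have hbad : (#bad : ℝ) ≤ q / 2 * Fintype.card B := by
    calc (#bad : ℝ) ≤ ∑ a ∈ S', (#(G.nbhdLeft 2 a) : ℝ) := mod_cast card_biUnion_le
      _ ≤ ∑ _a ∈ S', ρ * Fintype.card B := sum_le_sum fun a ha => hS a (hS' ha)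
      _ = (packingBound k (q / 2) + 1) * ρ * Fintype.card B := by
          rw [sum_const, hcard, nsmul_eq_mul]; push_cast; ring
      _ ≤ q / 2 * Fintype.card B := by gcongr
  have hcolor {a : A} (ha : a ∈ S') {b : B} (hb : b ∈ badᶜ) (h₀ : G.color a b ≠ 0) :
      G.color a b = 1 := by
    have h₂ : G.color a b ≠ 2 := fun h =>
      mem_compl.1 hb (mem_biUnion.2 ⟨a, ha, by simpa [nbhdLeft] using h⟩)
    lia
  have hR : ¬ HasShatteredSet (fun a b => G.color a b = 0) S' badᶜ k :=
    fun ⟨x, y, hx, hy, hxy⟩ => hG <| Or.inr ⟨x, y, fun i s => ⟨(hxy i s).2,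
      fun his => hcolor (hy s) (hx i) fun h => his ((hxy i s).1 h)⟩⟩
  have hle := card_le_packingBound hR (half_pos hq) (by linarith) fun a ha a' ha' hne => by
    have hsplit : disagreement (fun a b => G.color a b = 0) univ a a' ⊆
        disagreement (fun a b => G.color a b = 0) badᶜ a a' ∪ bad := fun b hb => by
      by_cases hb' : b ∈ bad <;> simp_all [mem_disagreement]
    have hadd : (#(disagreement (fun a b => G.color a b = 0) univ a a') : ℝ) ≤
        #(disagreement (fun a b => G.color a b = 0) badᶜ a a') + #bad :=
      mod_cast (card_le_card hsplit).trans (card_union_le _ _)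
    have hcompl : (#badᶜ : ℝ) ≤ Fintype.card B := mod_cast card_le_univ _
    nlinarith [hsep (hS' ha) (hS' ha') hne]
  lia

variable [Fintype A]

theorem mem_edgeClass {G : ColoredBipartite A B} {u : Fin 3} {p : A × B} :
    p ∈ G.edgeClass u ↔ G.color p.1 p.2 = u := by
  simp [edgeClass]

theorem card_edgeClass_swap (G : ColoredBipartite A B) (u : Fin 3) :
    #(G.swap.edgeClass u) = #(G.edgeClass u) :=
  card_equiv (Equiv.prodComm B A) fun p => by simp [mem_edgeClass, swap]

theorem card_edgeClass_eq_sum (G : ColoredBipartite A B) (u : Fin 3) :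
    #(G.edgeClass u) = ∑ a, #(G.nbhdLeft u a) := by
  simp only [edgeClass, nbhdLeft, card_filter, Fintype.sum_prod_type]

section Partition

variable [DecidableEq A] [DecidableEq B]

theorem sum_card_edgeClass_inter (G : ColoredBipartite A B) (u : Fin 3)
    (P : Finpartition (univ : Finset A)) (Q : Finpartition (univ : Finset B)) :
    ∑ X ∈ P.parts, ∑ Y ∈ Q.parts, #(G.edgeClass u ∩ X ×ˢ Y) = #(G.edgeClass u) := by
  simp only [edgeClass, filter_inter, univ_inter, card_filter, sum_product, Fintype.sum_prod_type]
  rw [← sum_parts P fun a => ∑ b, if G.color a b = u then 1 else 0]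
  refine sum_congr rfl fun X _ => ?_
  rw [sum_comm]
  exact sum_congr rfl fun a _ => sum_parts Q fun b => if G.color a b = u then 1 else 0

theorem card_biUnion_product (P : Finpartition (univ : Finset A))
    (Q : Finpartition (univ : Finset B))
    {S : Finset (Finset A × Finset B)} (hS : S ⊆ P.parts ×ˢ Q.parts) :
    #(S.biUnion fun p => p.1 ×ˢ p.2) = ∑ p ∈ S, #p.1 * #p.2 := by
  simp only [← card_product]
  refine card_biUnion fun p hp p' hp' hne => disjoint_product.2 ?_
  have hp := mem_product.1 (hS hp)
  have hp' := mem_product.1 (hS hp')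
  by_cases h : p.1 = p'.1
  · exact Or.inr (Q.disjoint hp.2 hp'.2 fun h' => hne (Prod.ext h h'))
  · exact Or.inl (P.disjoint hp.1 hp'.1 h)

theorem isHomogeneous_of_sum_le {G : ColoredBipartite A B} {η : ℝ}
    {P : Finpartition (univ : Finset A)} {Q : Finpartition (univ : Finset B)}
    (h : ∑ p ∈ P.parts ×ˢ Q.parts with
        ¬ (G.IsHomogeneousCell η 0 p.1 p.2 ∨ G.IsHomogeneousCell η 1 p.1 p.2),
      (#p.1 * #p.2 : ℝ) ≤ η * (Fintype.card A * Fintype.card B)) :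
    G.IsHomogeneous η P Q := by
  refine ⟨{p ∈ P.parts ×ˢ Q.parts | G.IsHomogeneousCell η 0 p.1 p.2}, filter_subset _ _,
    {p ∈ P.parts ×ˢ Q.parts | G.IsHomogeneousCell η 1 p.1 p.2}, filter_subset _ _, ?_,
    fun p hp => (mem_filter.1 hp).2, fun p hp => (mem_filter.1 hp).2⟩
  rw [← filter_or, card_biUnion_product P Q (filter_subset _ _)]
  have htotal : ∑ p ∈ P.parts ×ˢ Q.parts, (#p.1 * #p.2 : ℝ) =
      Fintype.card A * Fintype.card B := by
    simp only [sum_product, ← sum_mul_sum]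
    exact_mod_cast congrArg₂ (· * ·) P.sum_card_parts Q.sum_card_parts
  rw [← sum_filter_add_sum_filter_not _ fun p => G.IsHomogeneousCell η 0 p.1 p.2 ∨
    G.IsHomogeneousCell η 1 p.1 p.2] at htotal
  push_cast
  linarith

theorem isHomogeneous_of_deviation_le {G : ColoredBipartite A B} {η : ℝ} (hη : 0 < η)
    {P : Finpartition (univ : Finset A)} {Q : Finpartition (univ : Finset B)}
    (h : 2 * #(G.edgeClass 2) +
        4 * (∑ X ∈ P.parts, deviation (fun a b => G.color a b = 0) X univ +
          ∑ Y ∈ Q.parts, deviation (fun b a => G.color a b = 0) Y univ) ≤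
      η ^ 2 * (Fintype.card A * Fintype.card B)) :
    G.IsHomogeneous η P Q := by
  refine isHomogeneous_of_sum_le (le_of_mul_le_mul_left ?_ hη)
  set R : A → B → Prop := fun a b => G.color a b = 0
  calc η * ∑ p ∈ P.parts ×ˢ Q.parts with
          ¬ (G.IsHomogeneousCell η 0 p.1 p.2 ∨ G.IsHomogeneousCell η 1 p.1 p.2),
        (#p.1 * #p.2 : ℝ)
    _ ≤ ∑ p ∈ P.parts ×ˢ Q.parts, (2 * (#(G.edgeClass 2 ∩ p.1 ×ˢ p.2) : ℝ) +
          4 * (deviation R p.1 p.2 + deviation (fun b a => R a b) p.2 p.1)) := by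
        rw [mul_sum]
        refine (sum_le_sum fun p hp => ?_).trans (sum_le_sum_of_subset_of_nonneg
          (filter_subset _ _) fun p _ _ => ?_)
        · obtain ⟨h₀, h₁⟩ := not_or.1 (mem_filter.1 hp).2
          exact mul_card_le_of_not_isHomogeneousCell h₀ h₁
        · have h₁ := deviation_nonneg R p.1 p.2
          have h₂ := deviation_nonneg (fun b a => R a b) p.2 p.1
          positivity
    _ = 2 * #(G.edgeClass 2) + 4 * (∑ X ∈ P.parts, deviation R X univ +
          ∑ Y ∈ Q.parts, deviation (fun b a => R a b) Y univ) := by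
        rw [← G.sum_card_edgeClass_inter 2 P Q]
        push_cast
        simp only [sum_add_distrib, ← mul_sum, sum_product, sum_deviation_parts]
        rw [sum_comm (f := fun X Y => deviation (fun b a => R a b) Y X)]
        simp only [sum_deviation_parts]
    _ ≤ η * (η * (Fintype.card A * Fintype.card B)) := by rw [← mul_assoc, ← sq]; exact h

end Partition

end ColoredBipartite

namespace ColoredBipartite

variable {A B : Type*} [Fintype A] [Fintype B] {k : ℕ} {q ρ : ℝ}

theorem sum_card_of_nbhdLeft_gt_le {G : ColoredBipartite A B} (hρ : 0 < ρ)
    (hE : #(G.edgeClass 2) ≤ ρ ^ 2 * (Fintype.card A * Fintype.card B)) :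
    ∑ a : A with ρ * Fintype.card B < #(G.nbhdLeft 2 a), (Fintype.card B : ℝ) ≤
      ρ * (Fintype.card A * Fintype.card B) := by
  refine le_of_mul_le_mul_left ?_ hρ
  calc _ ≤ ∑ a, (#(G.nbhdLeft 2 a) : ℝ) :=
        mul_sum_filter_le_sum (fun a _ => Nat.cast_nonneg _) fun a _ ha => ha.le
    _ = #(G.edgeClass 2) := mod_cast (G.card_edgeClass_eq_sum 2).symm
    _ ≤ _ := by rwa [← mul_assoc, ← sq]

theorem exists_partition_sum_deviation_le [DecidableEq A] {G : ColoredBipartite A B}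
    (hG : ¬ G.HasCopy 0 1 k) (hq : 0 < q) (hq1 : q ≤ 1) (hρ : 0 < ρ)
    (hρq : (packingBound k (q / 2) + 1) * ρ ≤ q / 2)
    (hE : #(G.edgeClass 2) ≤ ρ ^ 2 * (Fintype.card A * Fintype.card B)) :
    ∃ P : Finpartition (univ : Finset A), #P.parts ≤ packingBound k (q / 2) + 1 ∧
      ∑ X ∈ P.parts, deviation (fun a b => G.color a b = 0) X univ ≤
        2 * (q + ρ) * (Fintype.card A * Fintype.card B) := by
  set R : A → B → Prop := fun a b => G.color a b = 0
  set n : ℝ := (Fintype.card B : ℝ)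
  obtain ⟨f, hf⟩ := exists_clustering (R := R) (T := univ) (d := q * n)
    (X := {a | #(G.nbhdLeft 2 a) ≤ ρ * n}) (by positivity)
    fun S hS hsep => card_le_packingBound_of_not_hasCopy hG hq hq1 hρq
      (fun a ha => (mem_filter.1 (hS ha)).2) hsep
  refine ⟨fiberPartition univ f, by simpa using card_fiberPartition_le univ f, ?_⟩
  set w : A → ℝ := fun a => q * n + if ρ * n < #(G.nbhdLeft 2 a) then n else 0 with hwdef
  have hw (a a' : A) (h : f a = f a') : #(disagreement R univ a a') ≤ w a + w a' := by
    have hn : 0 ≤ q * n := by positivity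
    have hn' : 0 ≤ n := by positivity
    have hle : (#(disagreement R univ a a') : ℝ) ≤ n :=
      Nat.cast_le.2 (card_le_univ _)
    by_cases ha : ρ * n < #(G.nbhdLeft 2 a)
    · simp only [hwdef, if_pos ha]; split_ifs <;> linarith
    by_cases ha' : ρ * n < #(G.nbhdLeft 2 a')
    · simp only [hwdef, if_pos ha']; split_ifs; linarith
    have hclose := hf a (by simpa using ha) a' (by simpa using ha') h
    simp only [hwdef, if_neg ha, if_neg ha']
    linarith
  calc ∑ X ∈ (fiberPartition univ f).parts, deviation R X univ
    _ ≤ ∑ X ∈ (fiberPartition univ f).parts, 2 * ∑ a ∈ X, w a :=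
        sum_le_sum fun X hX => deviation_le_two_mul_sum fun a ha a' ha' =>
          hw a a' (eq_of_mem_fiberPartition hX ha ha')
    _ = 2 * ∑ a, w a := by rw [← mul_sum, sum_parts]
    _ = 2 * (Fintype.card A * (q * n) + ∑ a with ρ * n < #(G.nbhdLeft 2 a), n) := by
        rw [hwdef, sum_add_distrib, sum_const, nsmul_eq_mul, card_univ, ← sum_filter]
    _ ≤ 2 * (q + ρ) * (Fintype.card A * n) := by linarith [sum_card_of_nbhdLeft_gt_le hρ hE]

theorem exists_isHomogeneous [DecidableEq A] [DecidableEq B] {G : ColoredBipartite A B}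
    (hG : ¬ G.HasCopy 0 1 k) (hq : 0 < q) (hq1 : q ≤ 1) (hρ : 0 < ρ)
    (hρq : (packingBound k (q / 2) + 1) * ρ ≤ q / 2)
    (hE : #(G.edgeClass 2) ≤ ρ ^ 2 * (Fintype.card A * Fintype.card B)) {η : ℝ} (hη : 0 < η)
    (hqη : 2 * ρ ^ 2 + 16 * (q + ρ) ≤ η ^ 2) :
    ∃ (P : Finpartition (univ : Finset A)) (Q : Finpartition (univ : Finset B)),
      G.IsHomogeneous η P Q ∧ #P.parts ≤ packingBound k (q / 2) + 1 ∧
        #Q.parts ≤ packingBound k (q / 2) + 1 := by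
  obtain ⟨P, hP, hPdev⟩ := exists_partition_sum_deviation_le hG hq hq1 hρ hρq hE
  obtain ⟨Q, hQ, hQdev⟩ := exists_partition_sum_deviation_le (mt hasCopy_swap.1 hG) hq hq1 hρ hρq
    (by rwa [card_edgeClass_swap, mul_comm (Fintype.card B : ℝ)])
  refine ⟨P, Q, isHomogeneous_of_deviation_le hη ?_, hP, hQ⟩
  have hAB : (0 : ℝ) ≤ Fintype.card A * Fintype.card B := by positivity
  rw [mul_comm (Fintype.card B : ℝ)] at hQdev
  simp only [swap] at hQdev
  nlinarith [mul_le_mul_of_nonneg_right hqη hAB]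

end ColoredBipartite

theorem packingBound_le {k : ℕ} {q : ℝ} (hq : 0 < q) :
    (packingBound k q : ℝ) ≤ (18 * ((k : ℝ) + 1) ^ 2 / q ^ 2) ^ k :=
  Nat.floor_le (by positivity)

/-- A removal constant for `k`: the factor `(18 (k + 1)² / q²) ^ k` of `packingBound k q` at
`q = √δ / 16`, without its power of `δ`. -/
def removalConstant (k : ℕ) : ℝ := (4608 * ((k : ℝ) + 1) ^ 2) ^ k

theorem one_le_removalConstant (k : ℕ) : 1 ≤ removalConstant k :=
  one_le_pow₀ (by nlinarith [Nat.cast_nonneg (α := ℝ) k])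

theorem packingBound_sqrt_add_one_le (k : ℕ) {δ : ℝ} (hδ : 0 < δ) (hδ1 : δ ≤ 1) :
    (packingBound k (√δ / 8 / 2) + 1 : ℝ) ≤ 2 * removalConstant k * ((δ / 8) ^ k)⁻¹ := by
  have hsq : (√δ / 8 / 2) ^ 2 = δ / 256 := by
    rw [div_pow, div_pow, Real.sq_sqrt hδ.le]; ring
  have hpow : (δ / 8) ^ k ≤ 1 := pow_le_one₀ (by positivity) (by linarith)
  have hone : 1 ≤ removalConstant k * ((δ / 8) ^ k)⁻¹ :=
    one_le_mul_of_one_le_of_one_le (one_le_removalConstant k) ((one_le_inv₀ (by positivity)).2 hpow)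
  have hbound := calc
    (packingBound k (√δ / 8 / 2) : ℝ) ≤ (18 * ((k : ℝ) + 1) ^ 2 / (√δ / 8 / 2) ^ 2) ^ k :=
        packingBound_le (by positivity)
    _ = removalConstant k * (δ ^ k)⁻¹ := by
        rw [hsq, removalConstant, ← inv_pow, ← mul_pow]; congr 1; ring
    _ ≤ removalConstant k * ((δ / 8) ^ k)⁻¹ := by
        have := one_le_removalConstant k
        gcongr; linarith
  linarith

theorem isRemovalConstant_removalConstant (k : ℕ) : IsRemovalConstant k (removalConstant k) := by
  have hc : 1 ≤ removalConstant k := one_le_removalConstant k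
  refine ⟨by positivity, fun ε δ _ _ hδ hδ2 hεδ A B _ _ _ _ G hE hG => ?_⟩
  set c := removalConstant k
  set q := √δ / 8 with hqdef
  set ρ := (c ^ 2)⁻¹ * (δ / 8) ^ (2 * k + 2) with hρdef
  have hparts : (packingBound k (q / 2) + 1 : ℝ) ≤ 2 * c * ((δ / 8) ^ k)⁻¹ :=
    packingBound_sqrt_add_one_le k hδ (by linarith)
  have hsqrt : √δ ≤ 1 := Real.sqrt_le_one.2 (by linarith)
  have hsq : √δ ^ 2 = δ := Real.sq_sqrt hδ.le
  have hq : 0 < q := by positivity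
  have hρ : 0 < ρ := by positivity
  have hρq : (packingBound k (q / 2) + 1) * ρ ≤ q / 2 := calc
    _ ≤ 2 * c * ((δ / 8) ^ k)⁻¹ * ρ := by gcongr
    _ = 2 * c⁻¹ * (δ / 8) ^ k * (δ / 8) ^ 2 := by
        rw [hρdef, pow_add, two_mul k, pow_add]; field_simp
    _ ≤ 2 * 1 * 1 * (δ / 8) ^ 2 := by
        gcongr
        · exact inv_le_one_of_one_le₀ hc
        · exact pow_le_one₀ (by positivity) (by linarith)
    _ ≤ q / 2 := by nlinarith
  have hρq' : ρ ≤ q / 2 :=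
    (le_mul_of_one_le_left hρ.le (by simp)).trans hρq
  have hερ : ε ≤ ρ ^ 2 := hεδ.trans <| by
    have : ρ ^ 2 = (c ^ 4)⁻¹ * (δ / 8) ^ (4 * k + 4) := by
      rw [hρdef, mul_pow, inv_pow, ← pow_mul, ← pow_mul]; ring_nf
    rw [← this]; linarith [sq_nonneg ρ]
  have hη : √δ ≤ (δ ^ (1 / 16 : ℝ)) ^ 2 := by
    rw [Real.sqrt_eq_rpow, ← Real.rpow_natCast, ← Real.rpow_mul hδ.le]
    exact Real.rpow_le_rpow_of_exponent_ge hδ (by linarith) (by norm_num)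
  obtain ⟨P, Q, hPQ, hP, hQ⟩ := ColoredBipartite.exists_isHomogeneous hG hq
    (by linarith) hρ hρq (hE.trans (by rw [mul_assoc]; gcongr))
    (η := 2 * δ ^ (1 / 16 : ℝ)) (by positivity) (by rw [mul_pow]; nlinarith)
  exact ⟨P, Q, hPQ, le_trans (mod_cast hP) hparts, le_trans (mod_cast hQ) hparts⟩

section Prediction

variable {α : Type*} [DecidableEq α]

theorem ThreeGraph.slice_adj {H : ThreeGraph α} {x y z : α} :
    (H.slice x).Adj y z ↔ {x, y, z} ∈ H.edges := by
  refine and_iff_right_of_imp fun h hyz => ?_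
  have hcard := H.card_of_mem _ h
  have hle : #({x, y, z} : Finset α) ≤ 2 := by
    rw [hyz, pair_eq_singleton]
    exact card_le_two
  lia

theorem ThreeGraph.slice_adj_rotate {H : ThreeGraph α} {x y z : α} :
    (H.slice x).Adj y z ↔ (H.slice z).Adj x y := by
  rw [slice_adj, slice_adj]
  congr! 1
  grind

theorem ThreeGraph.mem_nbhd [Fintype α] {H : ThreeGraph α} {x y z : α} :
    y ∈ H.nbhd x z ↔ (H.slice x).Adj y z := by
  rw [slice_adj, pair_comm y z]
  simp [nbhd]

theorem nearZeroOne_of_card_filter_lt {X N : Finset α} {η : ℝ} {p : Prop} (hX : X.Nonempty)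
    (h : #{y ∈ X | ¬ (y ∈ N ↔ p)} < η * #X) : NearZeroOne η (#(N ∩ X) / #X : ℝ) := by
  have hX' : (0 : ℝ) < #X := mod_cast hX.card_pos
  have hsplit : (#(N ∩ X) : ℝ) + #{y ∈ X | y ∉ N} = #X := by
    rw [inter_comm, ← filter_mem_eq_inter]
    exact mod_cast card_filter_add_card_filter_not (s := X) (· ∈ N)
  by_cases hp : p
  · simp only [hp, iff_true] at h
    have : (0 : ℝ) ≤ #{y ∈ X | y ∉ N} := Nat.cast_nonneg _
    exact .inr ⟨(lt_div_iff₀ hX').2 (by linarith), (div_le_one hX').2 (by linarith)⟩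
  · simp only [hp, iff_false, not_not, filter_mem_eq_inter] at h
    exact .inl ⟨by positivity, (div_lt_iff₀ hX').2 (by rwa [inter_comm])⟩

variable [Fintype α] {H : ThreeGraph α} {U V W X : Finset α} {η : ℝ}

theorem ThreeGraph.isAlmostGood_of_prediction (hη : 0 < η) (hX : X.Nonempty) {σ : α × α → Prop}
    (hσ : ∑ p ∈ U ×ˢ W, (#{y ∈ X | ¬ (y ∈ H.nbhd p.1 p.2 ↔ σ p)} : ℝ) ≤
      η ^ 2 * (#X * #(U ×ˢ W))) : H.IsAlmostGood U W η X := by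
  have hX' : (0 : ℝ) < #X := mod_cast hX.card_pos
  set good : α × α → Prop := fun p => NearZeroOne η (#(H.nbhd p.1 p.2 ∩ X) / #X : ℝ)
  have hbad : η * (#X * #{p ∈ U ×ˢ W | ¬ good p}) ≤ η * (#X * (η * #(U ×ˢ W))) := calc
    _ = η * ∑ p ∈ U ×ˢ W with ¬ good p, (#X : ℝ) := by
        rw [sum_const, nsmul_eq_mul, mul_comm (#X : ℝ)]
    _ ≤ _ := mul_sum_filter_le_sum (fun p _ => Nat.cast_nonneg _) fun p _ hp =>
        not_lt.1 fun hlt => hp (nearZeroOne_of_card_filter_lt hX hlt)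
    _ ≤ _ := hσ
    _ = _ := by ring
  have hbad' := le_of_mul_le_mul_left (le_of_mul_le_mul_left hbad hη) hX'
  have hsplit : (#{p ∈ U ×ˢ W | good p} : ℝ) + #{p ∈ U ×ˢ W | ¬ good p} = #(U ×ˢ W) :=
    mod_cast card_filter_add_card_filter_not (s := U ×ˢ W) good
  rw [IsAlmostGood, mul_assoc, ← Nat.cast_mul, ← card_product]
  change _ ≤ (#{p ∈ U ×ˢ W | good p} : ℝ)
  linarith

theorem ThreeGraph.isAlmostGoodPartition_of_prediction {ι : Type*} (hη : 0 < η) {f : α → ι}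
    {σ : α × α → ι → Prop}
    (hσ : ∑ p ∈ U ×ˢ W, (#{y ∈ V | ¬ (y ∈ H.nbhd p.1 p.2 ↔ σ p (f y))} : ℝ) ≤
      η ^ 3 * (#(U ×ˢ W) * #V)) : H.IsAlmostGoodPartition U W η (fiberPartition V f) := by
  set P := fiberPartition V f
  set err : Finset α → ℝ := fun X =>
    ∑ p ∈ U ×ˢ W, (#{y ∈ X | ¬ (y ∈ H.nbhd p.1 p.2 ↔ σ p (f y))} : ℝ)
  set bad : Finset α → Prop := fun X => η ^ 2 * (#X * #(U ×ˢ W)) < err X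
  have herr (X) : 0 ≤ err X := sum_nonneg fun _ _ => Nat.cast_nonneg _
  have hsum : ∑ X ∈ P.parts, err X = err V := by
    rw [sum_comm]
    exact sum_congr rfl fun p _ => mod_cast sum_card_filter_parts P _
  have hbad : ∑ X ∈ P.parts with bad X, (#X : ℝ) ≤ η * #V := by
    obtain h0 | hpos := (U ×ˢ W).eq_empty_or_nonempty
    · simp only [bad, err, h0, sum_empty, card_empty, Nat.cast_zero, mul_zero, lt_self_iff_false,
        filter_false]
      positivity
    have hpos' : (0 : ℝ) < η ^ 2 * #(U ×ˢ W) := by positivity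
    refine le_of_mul_le_mul_left ?_ hpos'
    calc _ ≤ ∑ X ∈ P.parts, err X :=
          mul_sum_filter_le_sum (fun X _ => herr X) fun X _ hX => by
            simp only [bad] at hX; linarith
      _ ≤ _ := by rw [hsum]; linarith
  have hsplit : ∑ X ∈ P.parts with bad X, (#X : ℝ) + ∑ X ∈ P.parts with ¬ bad X, (#X : ℝ) = #V := by
    rw [sum_filter_add_sum_filter_not]
    exact mod_cast P.sum_card_parts
  refine ⟨{X ∈ P.parts | ¬ bad X}, filter_subset _ _, ?_, fun X hX => ?_⟩
  · rw [card_biUnion fun X hX Y hY => P.disjoint (mem_filter.1 hX).1 (mem_filter.1 hY).1]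
    push_cast
    simp only [id]
    linarith
  · obtain ⟨hXP, hX⟩ := mem_filter.1 hX
    obtain ⟨a, ha⟩ := P.nonempty_of_mem_parts hXP
    refine isAlmostGood_of_prediction hη ⟨a, ha⟩ (σ := fun p => σ p (f a)) ?_
    have hconst (p) : {y ∈ X | ¬ (y ∈ H.nbhd p.1 p.2 ↔ σ p (f a))} =
        {y ∈ X | ¬ (y ∈ H.nbhd p.1 p.2 ↔ σ p (f y))} :=
      filter_congr fun y hy => by rw [eq_of_mem_fiberPartition hXP ha hy]
    simpa only [hconst] using not_lt.1 hX

end Prediction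

section Sampling

variable {α β γ : Type*} {R : α → β → γ → Prop} {U : Finset α} {V : Finset β} {W T : Finset γ}

theorem exists_sample (hW : W.Nonempty) {r : α × γ → γ → Prop} {q b : ℝ} (hq1 : q ≤ 1)
    (hr : ∀ x ∈ U, (#{z ∈ W | #{z' ∈ W | r (x, z) z'} < q * #W} : ℝ) ≤ b * #W) (t : ℕ) :
    ∃ T ⊆ W, #T ≤ t ∧ (#{p ∈ U ×ˢ W | ∀ z' ∈ T, ¬ r p z'} : ℝ) ≤ (b + (1 - q) ^ t) * #(U ×ˢ W) := by
  set few : α × γ → Prop := fun p => #{z' ∈ W | r p z'} < q * #W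
  obtain ⟨T, hTW, hT, hmiss⟩ := exists_hitting_set hW {p ∈ U ×ˢ W | ¬ few p} r hq1
    (fun p hp => not_lt.1 (mem_filter.1 hp).2) t
  refine ⟨T, hTW, hT, ?_⟩
  have hfew : (#{p ∈ U ×ˢ W | few p} : ℝ) ≤ b * #(U ×ˢ W) := by
    rw [card_filter, sum_product, card_product]
    push_cast
    calc ∑ x ∈ U, ∑ z ∈ W, (if few (x, z) then (1 : ℝ) else 0) ≤ ∑ _x ∈ U, b * #W :=
          sum_le_sum fun _ hx => by rw [sum_boole]; exact hr _ hx
      _ = b * (#U * #W) := by rw [sum_const, nsmul_eq_mul]; ring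
  have hsub : {p ∈ U ×ˢ W | ∀ z' ∈ T, ¬ r p z'} ⊆ {p ∈ U ×ˢ W | few p} ∪
      {p ∈ {p ∈ U ×ˢ W | ¬ few p} | ∀ z' ∈ T, ¬ r p z'} := by
    intro p hp
    simp only [mem_union, mem_filter] at hp ⊢
    tauto
  calc (#{p ∈ U ×ˢ W | ∀ z' ∈ T, ¬ r p z'} : ℝ)
    _ ≤ #{p ∈ U ×ˢ W | few p} + #{p ∈ {p ∈ U ×ˢ W | ¬ few p} | ∀ z' ∈ T, ¬ r p z'} :=
        mod_cast (card_le_card hsub).trans (card_union_le _ _)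
    _ ≤ b * #(U ×ˢ W) + (1 - q) ^ t * #{p ∈ U ×ˢ W | ¬ few p} := add_le_add hfew hmiss
    _ ≤ (b + (1 - q) ^ t) * #(U ×ˢ W) := by
        rw [add_mul]
        have := pow_nonneg (sub_nonneg.2 hq1) t
        gcongr
        exact filter_subset _ _

theorem sum_sum_card_filter_not_iff_le {g : β → β} {d : ℝ}
    (hg : ∀ z ∈ T, ∀ y ∈ V, #(disagreement (fun y x => R x y z) U y (g y)) ≤ d * #U) :
    ∑ x ∈ U, ∑ z ∈ T, (#{y ∈ V | ¬ (R x y z ↔ R x (g y) z)} : ℝ) ≤ #T * d * (#U * #V) := by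
  calc ∑ x ∈ U, ∑ z ∈ T, (#{y ∈ V | ¬ (R x y z ↔ R x (g y) z)} : ℝ)
    _ = ∑ z ∈ T, ∑ y ∈ V, (#(disagreement (fun y x => R x y z) U y (g y)) : ℝ) := by
        rw [sum_comm]
        refine sum_congr rfl fun z _ => ?_
        simp only [disagreement, card_filter, Nat.cast_sum]
        exact sum_comm
    _ ≤ ∑ _z ∈ T, ∑ _y ∈ V, d * #U := sum_le_sum fun z hz => sum_le_sum fun y hy => hg z hz y hy
    _ = #T * d * (#U * #V) := by simp only [sum_const, nsmul_eq_mul]; ring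

theorem card_filter_not_iff_le_add (R : α → β → γ → Prop) (V : Finset β) {x : α} {z z' : γ}
    {g : β → β} (hz' : z' ∈ T) :
    (#{y ∈ V | ¬ (R x y z ↔ R x (g y) z')} : ℝ) ≤
      #(disagreement (fun z y => R x y z) V z z') +
        ∑ w ∈ T, (#{y ∈ V | ¬ (R x y w ↔ R x (g y) w)} : ℝ) := by
  have hsub : {y ∈ V | ¬ (R x y z ↔ R x (g y) z')} ⊆
      disagreement (fun z y => R x y z) V z z' ∪ {y ∈ V | ¬ (R x y z' ↔ R x (g y) z')} := by
    intro y hy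
    simp only [mem_union, mem_disagreement, mem_filter] at hy ⊢
    tauto
  calc (#{y ∈ V | ¬ (R x y z ↔ R x (g y) z')} : ℝ)
    _ ≤ #(disagreement (fun z y => R x y z) V z z') + #{y ∈ V | ¬ (R x y z' ↔ R x (g y) z')} :=
        mod_cast (card_le_card hsub).trans (card_union_le _ _)
    _ ≤ _ := by
        gcongr
        exact single_le_sum (f := fun w => (#{y ∈ V | ¬ (R x y w ↔ R x (g y) w)} : ℝ))
          (fun _ _ => Nat.cast_nonneg _) hz'

theorem exists_prediction {ι : Type*} {f : β → ι} {b δ d : ℝ} (hδ : 0 ≤ δ)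
    (hbad : (#{p ∈ U ×ˢ W | ∀ z' ∈ T, ¬ (#(disagreement (fun z y => R p.1 y z) V p.2 z') : ℝ) ≤
      δ * #V} : ℝ) ≤ b * #(U ×ˢ W))
    (hf : ∀ z ∈ T, ∀ y ∈ V, ∀ y' ∈ V, f y = f y' →
      #(disagreement (fun y x => R x y z) U y y') ≤ d * #U) :
    ∃ σ : α × γ → ι → Prop, ∑ p ∈ U ×ˢ W, (#{y ∈ V | ¬ (R p.1 y p.2 ↔ σ p (f y))} : ℝ) ≤
      (b + δ + #T * d) * (#(U ×ˢ W) * #V) := by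
  obtain rfl | ⟨y₀, -⟩ := V.eq_empty_or_nonempty
  · exact ⟨fun _ _ => False, by simp⟩
  have : Nonempty β := ⟨y₀⟩
  set close : α × γ → γ → Prop := fun p z' =>
    (#(disagreement (fun z y => R p.1 y z) V p.2 z') : ℝ) ≤ δ * #V
  have hrep (p : α × γ) : ∃ z', (∃ z ∈ T, close p z) → z' ∈ T ∧ close p z' := by
    by_cases hp : ∃ z ∈ T, close p z
    · exact hp.imp fun _ hz _ => hz
    · exact ⟨p.2, fun h => absurd h hp⟩
  choose rep hrep using hrep
  set g : β → β := fun y => Function.invFunOn f V (f y)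
  have hg (y) (hy : y ∈ V) : g y ∈ V ∧ f (g y) = f y := Function.invFunOn_pos ⟨y, hy, rfl⟩
  refine ⟨fun p i => R p.1 (Function.invFunOn f V i) (rep p), ?_⟩
  set sep : α → ℝ := fun x => ∑ z ∈ T, (#{y ∈ V | ¬ (R x y z ↔ R x (g y) z)} : ℝ)
  have hsep : ∑ p ∈ U ×ˢ W, sep p.1 ≤ #T * d * (#(U ×ˢ W) * #V) := by
    simp only [sum_product_right, sum_const, nsmul_eq_mul, card_product, Nat.cast_mul]
    have := sum_sum_card_filter_not_iff_le fun z hz y hy =>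
      hf z hz y hy (g y) (hg y hy).1 (hg y hy).2.symm
    nlinarith [Nat.cast_nonneg (α := ℝ) #W]
  have herr (p : α × γ) : (#{y ∈ V | ¬ (R p.1 y p.2 ↔ R p.1 (g y) (rep p))} : ℝ) ≤
      (if ∀ z' ∈ T, ¬ close p z' then (#V : ℝ) else 0) + δ * #V + sep p.1 := by
    split_ifs with hp
    · have hle : (#{y ∈ V | ¬ (R p.1 y p.2 ↔ R p.1 (g y) (rep p))} : ℝ) ≤ #V :=
        mod_cast card_filter_le _ _
      have hsep : 0 ≤ sep p.1 := sum_nonneg fun _ _ => Nat.cast_nonneg _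
      linarith [mul_nonneg hδ (Nat.cast_nonneg (α := ℝ) #V)]
    · obtain ⟨hT, hclose⟩ := hrep p (by push Not at hp; exact hp)
      linarith [card_filter_not_iff_le_add R V (x := p.1) (z := p.2) (g := g) hT]
  refine (sum_le_sum fun p _ => herr p).trans ?_
  rw [sum_add_distrib, sum_add_distrib, sum_const, ← sum_filter, sum_const]
  simp only [nsmul_eq_mul]
  linarith [mul_le_mul_of_nonneg_right hbad (Nat.cast_nonneg (α := ℝ) #V)]

end Sampling

section Slices

variable {β γ : Type*} {R : γ → β → Prop} {V : Finset β} {W C : Finset γ} {M : β → Prop} {s : ℝ}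

theorem card_filter_far_le (hs : 0 < s)
    (hM : ∑ z ∈ C, (#{y ∈ V | ¬ (R z y ↔ M y)} : ℝ) ≤ s ^ 2 * (#V * #C)) :
    (#{z ∈ C | s * #V < #{y ∈ V | ¬ (R z y ↔ M y)}} : ℝ) ≤ s * #C := by
  obtain rfl | hV := V.eq_empty_or_nonempty
  · simp only [card_empty, Nat.cast_zero, mul_zero, filter_empty, lt_self_iff_false, filter_false]
    positivity
  have hV' : (0 : ℝ) < #V := mod_cast hV.card_pos
  refine le_of_mul_le_mul_left ?_ (mul_pos hs hV')
  calc s * #V * #{z ∈ C | s * #V < #{y ∈ V | ¬ (R z y ↔ M y)}}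
    _ = s * ∑ z ∈ C with s * #V < #{y ∈ V | ¬ (R z y ↔ M y)}, (#V : ℝ) := by
        rw [sum_const, nsmul_eq_mul]; ring
    _ ≤ ∑ z ∈ C, (#{y ∈ V | ¬ (R z y ↔ M y)} : ℝ) :=
        mul_sum_filter_le_sum (fun _ _ => Nat.cast_nonneg _) fun _ _ h => h.le
    _ ≤ s * #V * (s * #C) := hM.trans_eq (by ring)

theorem card_disagreement_le_add (R : γ → β → Prop) (V : Finset β) (M : β → Prop) (z z' : γ) :
    #(disagreement R V z z') ≤ #{y ∈ V | ¬ (R z y ↔ M y)} + #{y ∈ V | ¬ (R z' y ↔ M y)} := by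
  refine (card_le_card fun y hy => ?_).trans (card_union_le _ _)
  simp only [mem_disagreement, mem_union, mem_filter] at hy ⊢
  tauto

theorem half_card_le_card_filter_close (hs : 0 < s) (hs2 : s ≤ 1 / 2) (hC : C ⊆ W)
    (hM : ∑ z ∈ C, (#{y ∈ V | ¬ (R z y ↔ M y)} : ℝ) ≤ s ^ 2 * (#V * #C)) {z : γ}
    (hz : (#{y ∈ V | ¬ (R z y ↔ M y)} : ℝ) ≤ s * #V) :
    (#C : ℝ) / 2 ≤ #{z' ∈ W | (#(disagreement R V z z') : ℝ) ≤ 2 * s * #V} := by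
  set far : γ → Prop := fun z => s * #V < #{y ∈ V | ¬ (R z y ↔ M y)}
  have hfar : (#{z ∈ C | far z} : ℝ) ≤ s * #C := card_filter_far_le hs hM
  have hsplit : (#{z ∈ C | far z} : ℝ) + #{z ∈ C | ¬ far z} = #C :=
    mod_cast card_filter_add_card_filter_not (s := C) far
  have hsub : {z ∈ C | ¬ far z} ⊆ {z' ∈ W | (#(disagreement R V z z') : ℝ) ≤ 2 * s * #V} := by
    intro z' hz'
    obtain ⟨hz'C, hz'⟩ := mem_filter.1 hz'
    have hle : (#(disagreement R V z z') : ℝ) ≤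
        #{y ∈ V | ¬ (R z y ↔ M y)} + #{y ∈ V | ¬ (R z' y ↔ M y)} :=
      mod_cast card_disagreement_le_add R V M z z'
    exact mem_filter.2 ⟨hC hz'C, by linarith [not_lt.1 hz']⟩
  have hle : (#{z ∈ C | ¬ far z} : ℝ) ≤ _ := Nat.cast_le.2 (card_le_card hsub)
  linarith [mul_le_mul_of_nonneg_right hs2 (Nat.cast_nonneg (α := ℝ) #C)]

variable {α : Type*} [DecidableEq α]

theorem IsIndexedPartition.sum_card_filter {m : ℕ} {X : Finset α} {B : Fin (m + 1) → Finset α}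
    (hB : IsIndexedPartition X B) (p : α → Prop) [DecidablePred p] :
    ∑ i, #{x ∈ B i | p x} = #{x ∈ X | p x} := by
  rw [← hB.2, filter_biUnion, card_biUnion fun i _ j _ hij =>
    disjoint_filter_filter (hB.1 i j hij)]

variable [Fintype α]

theorem sum_card_filter_not_adj_iff_le {G : SimpleGraph α} {X Y : Finset α} {τ : Bool} {ε : ℝ}
    (h : (1 - ε) * #X * #Y ≤ signedEdgeCount G τ X Y) :
    ∑ z ∈ Y, (#{y ∈ X | ¬ (G.Adj y z ↔ τ = true)} : ℝ) ≤ ε * (#X * #Y) := by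
  have hsub : signedEdgeCount G τ X Y ≤ #{p ∈ X ×ˢ Y | G.Adj p.1 p.2 ↔ τ = true} := by
    refine card_le_card fun p hp => ?_
    cases τ <;> simp_all [SimpleGraph.mem_interedges_iff]
  have hsplit : (#{p ∈ X ×ˢ Y | G.Adj p.1 p.2 ↔ τ = true} : ℝ) +
      #{p ∈ X ×ˢ Y | ¬ (G.Adj p.1 p.2 ↔ τ = true)} = #X * #Y := by
    rw [← Nat.cast_mul, ← card_product]
    exact mod_cast card_filter_add_card_filter_not (s := X ×ˢ Y) _
  have hsum : ∑ z ∈ Y, (#{y ∈ X | ¬ (G.Adj y z ↔ τ = true)} : ℝ) =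
      #{p ∈ X ×ˢ Y | ¬ (G.Adj p.1 p.2 ↔ τ = true)} := by
    rw [card_filter, sum_product_right]
    simp only [card_filter, Nat.cast_sum]
  have : (signedEdgeCount G τ X Y : ℝ) ≤ _ := Nat.cast_le.2 hsub
  linarith

theorem IsIndexedPartition.sum_card_filter_not_adj_iff_le {G : SimpleGraph α} {V Y : Finset α}
    {m : ℕ} {B : Fin (m + 1) → Finset α} (hB : IsIndexedPartition V B) {u : Fin (m + 1) → Fin 3}
    (hu : ∀ i, u i ≠ 2) {M : α → Prop} (hM : ∀ i, ∀ y ∈ B i, M y ↔ u i = 1) {ε : ℝ}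
    (h₀ : ∀ i, u i = 0 → (1 - ε) * #(B i) * #Y ≤ signedEdgeCount G false (B i) Y)
    (h₁ : ∀ i, u i = 1 → (1 - ε) * #(B i) * #Y ≤ signedEdgeCount G true (B i) Y) :
    ∑ z ∈ Y, (#{y ∈ V | ¬ (G.Adj y z ↔ M y)} : ℝ) ≤ ε * (#V * #Y) := by
  have hcell (i) : ∑ z ∈ Y, (#{y ∈ B i | ¬ (G.Adj y z ↔ M y)} : ℝ) ≤ ε * (#(B i) * #Y) := by
    have hcongr (z) : {y ∈ B i | ¬ (G.Adj y z ↔ M y)} =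
        {y ∈ B i | ¬ (G.Adj y z ↔ decide (u i = 1) = true)} :=
      filter_congr fun y hy => by rw [hM i y hy, decide_eq_true_iff]
    simp only [hcongr]
    refine SliceReg.sum_card_filter_not_adj_iff_le ?_
    by_cases hui : u i = 1
    · simpa [hui] using h₁ i hui
    · simpa [hui] using h₀ i (by have := hu i; lia)
  calc ∑ z ∈ Y, (#{y ∈ V | ¬ (G.Adj y z ↔ M y)} : ℝ)
    _ = ∑ i, ∑ z ∈ Y, (#{y ∈ B i | ¬ (G.Adj y z ↔ M y)} : ℝ) := by
        rw [sum_comm]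
        exact sum_congr rfl fun z _ => mod_cast (hB.sum_card_filter _).symm
    _ ≤ ∑ i, ε * (#(B i) * #Y) := sum_le_sum fun i _ => hcell i
    _ = ε * (#V * #Y) := by
        have : ∑ i, (#(B i) : ℝ) = #V := mod_cast by simpa using hB.sum_card_filter fun _ => True
        rw [← mul_sum, ← sum_mul, this]

theorem IsReducedSlice.exists_model {H : ThreeGraph α} {V W : Finset α} {ℓ m n : ℕ} {ε : ℝ}
    {𝒢 : ColoredBipartite (Fin (m + 1)) (Fin (n + 1))} {x : α}
    (h : IsReducedSlice H V W ℓ ε 𝒢 x) (h𝒢 : ∀ i j, j ≠ 0 → 𝒢.color i j ≠ 2) :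
    ∃ (C : Fin (n + 1) → Finset α) (M : Fin (n + 1) → α → Prop), IsIndexedPartition W C ∧
      (#(C 0) : ℝ) ≤ ε * #W ∧ ∀ j ≠ 0, (#(C j) : ℝ) = #W / ℓ ∧
        ∑ z ∈ C j, (#{y ∈ V | ¬ ((H.slice x).Adj y z ↔ M j y)} : ℝ) ≤ ε * (#V * #(C j)) := by
  obtain ⟨B, C, hB, hC, hc₀, hc₁, -, hCcard, -, hC₀⟩ := h
  refine ⟨C, fun j y => ∃ i, y ∈ B i ∧ 𝒢.color i j = 1, hC, hC₀, fun j hj => ⟨hCcard j hj,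
    hB.sum_card_filter_not_adj_iff_le (fun i => h𝒢 i j hj) (fun i y hy => ?_) (hc₀ · j) (hc₁ · j)⟩⟩
  refine ⟨fun ⟨i', hi', hcolor⟩ => ?_, fun hcolor => ⟨i, hy, hcolor⟩⟩
  by_contra hne
  exact disjoint_left.1 (hB.1 i i' fun hii' => hne (hii' ▸ hcolor)) hy hi'

theorem IsReducedSlice.card_filter_few_close_le {H : ThreeGraph α} {V W : Finset α} {ℓ m n : ℕ}
    {s : ℝ} (hs : 0 < s) (hs2 : s ≤ 1 / 2) {𝒢 : ColoredBipartite (Fin (m + 1)) (Fin (n + 1))}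
    {x : α} (h : IsReducedSlice H V W ℓ (s ^ 2) 𝒢 x) (h𝒢 : ∀ i j, j ≠ 0 → 𝒢.color i j ≠ 2) :
    (#{z ∈ W | #{z' ∈ W | (#(disagreement (fun z y => (H.slice x).Adj y z) V z z') : ℝ) ≤
      2 * s * #V} < 1 / (2 * (ℓ : ℝ)) * #W} : ℝ) ≤ 2 * s * #W := by
  obtain ⟨C, M, hC, hC₀, hM⟩ := h.exists_model h𝒢
  set far : Fin (n + 1) → Finset α := fun j =>
    {z ∈ C j | s * #V < #{y ∈ V | ¬ ((H.slice x).Adj y z ↔ M j y)}}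
  have hfar (j) (hj : j ∈ univ.erase (0 : Fin (n + 1))) : (#(far j) : ℝ) ≤ s * #(C j) :=
    card_filter_far_le (R := fun z y => (H.slice x).Adj y z) hs (hM j (ne_of_mem_erase hj)).2
  have hsub : {z ∈ W | #{z' ∈ W | (#(disagreement (fun z y => (H.slice x).Adj y z) V z z') : ℝ) ≤
      2 * s * #V} < 1 / (2 * (ℓ : ℝ)) * #W} ⊆ C 0 ∪ (univ.erase 0).biUnion far := by
    intro z hz
    obtain ⟨hzW, hz⟩ := mem_filter.1 hz
    obtain ⟨j, -, hzj⟩ := mem_biUnion.1 (hC.2.symm ▸ hzW)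
    by_cases hj : j = 0
    · exact mem_union_left _ (hj ▸ hzj)
    refine mem_union_right _ (mem_biUnion.2 ⟨j, mem_erase.2 ⟨hj, mem_univ j⟩, ?_⟩)
    refine mem_filter.2 ⟨hzj, not_le.1 fun hle => hz.not_ge ?_⟩
    calc 1 / (2 * (ℓ : ℝ)) * #W = #(C j) / 2 := by rw [(hM j hj).1]; ring
      _ ≤ _ := half_card_le_card_filter_close hs hs2
        (hC.2 ▸ subset_biUnion_of_mem C (mem_univ j)) (hM j hj).2 hle
  have hsum : ∑ j, (#(C j) : ℝ) = #W := mod_cast by simpa using hC.sum_card_filter fun _ => True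
  calc _ ≤ (#(C 0) : ℝ) + ∑ j ∈ univ.erase 0, (#(far j) : ℝ) :=
        mod_cast (card_le_card hsub).trans
          ((card_union_le _ _).trans (Nat.add_le_add_left card_biUnion_le _))
    _ ≤ s ^ 2 * #W + ∑ j ∈ univ.erase 0, s * (#(C j) : ℝ) := add_le_add hC₀ (sum_le_sum hfar)
    _ ≤ s ^ 2 * #W + s * #W := by
        rw [← mul_sum, ← hsum]
        gcongr
        exact erase_subset _ _
    _ ≤ 2 * s * #W := by nlinarith [mul_nonneg hs.le (Nat.cast_nonneg (α := ℝ) #W)]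

end Slices

theorem exists_joint_clustering {β γ ι : Type*} {V : Finset β} {T : Finset γ}
    {r : γ → β → β → Prop}
    (h : ∀ z ∈ T, ∃ f : β → ι, ∀ y ∈ V, ∀ y' ∈ V, f y = f y' → r z y y') :
    ∃ f : β → T → ι, ∀ z ∈ T, ∀ y ∈ V, ∀ y' ∈ V, f y = f y' → r z y y' := by
  choose f hf using fun z : T => h z z.2
  exact ⟨fun y z => f z y, fun z hz y hy y' hy' hyy' =>
    hf ⟨z, hz⟩ y hy y' hy' (congrFun hyy' ⟨z, hz⟩)⟩

section SliceClusters

variable {α : Type*} [DecidableEq α] {H : ThreeGraph α} {U V W : Finset α} {k : ℕ} {q : ℝ}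

theorem not_hasShatteredSet_of_vcDim_slice_lt {z : α} (hz : vcDim (H.slice z) < k) :
    ¬ HasShatteredSet (fun y x => (H.slice x).Adj y z) V U k := by
  rintro ⟨x, y, -, -, hxy⟩
  have hconfig : HasPowerSetConfig (H.slice z) k :=
    ⟨x, y, fun i S => ThreeGraph.slice_adj_rotate.symm.trans (hxy i S)⟩
  exact hz.not_ge <|
    le_iSup₂ (f := fun k (_ : HasPowerSetConfig (H.slice z) k) => (k : ℕ∞)) k hconfig

theorem exists_clustering_of_vcDim_slice_lt (hq : 0 < q) (hq1 : q ≤ 1) {z : α}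
    (hz : vcDim (H.slice z) < k) (U V : Finset α) :
    ∃ f : α → Fin (packingBound k q + 1), ∀ y ∈ V, ∀ y' ∈ V, f y = f y' →
      (#(disagreement (fun y x => (H.slice x).Adj y z) U y y') : ℝ) ≤ 2 * q * #U := by
  obtain ⟨f, hf⟩ := exists_clustering (R := fun y x => (H.slice x).Adj y z) (T := U) (X := V)
    (d := q * #U) (by positivity) fun S _ hS =>
      card_le_packingBound (not_hasShatteredSet_of_vcDim_slice_lt hz) hq hq1 hS
  exact ⟨f, fun y hy y' hy' h => (hf y hy y' hy' h).trans_eq (mul_assoc _ _ _).symm⟩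

variable [Fintype α]

theorem exists_isAlmostGoodPartition (hvc : ∀ z ∈ W, vcDim (H.slice z) < k) (hq : 0 < q)
    (hq1 : q ≤ 1) {ℓ m n : ℕ} (hℓ : 1 ≤ ℓ) {s : ℝ} (hs : 0 < s) (hs2 : s ≤ 1 / 2)
    {𝒢 : ColoredBipartite (Fin (m + 1)) (Fin (n + 1))}
    (hred : ∀ x ∈ U, IsReducedSlice H V W ℓ (s ^ 2) 𝒢 x) (h𝒢 : ∀ i j, j ≠ 0 → 𝒢.color i j ≠ 2)
    (t : ℕ) {η : ℝ} (hη : 0 < η)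
    (herr : 4 * s + (1 - 1 / (2 * (ℓ : ℝ))) ^ t + t * (2 * q) ≤ η ^ 3) :
    ∃ P : Finpartition V, H.IsAlmostGoodPartition U W η P ∧
      #P.parts ≤ (packingBound k q + 1) ^ t := by
  obtain rfl | hW := W.eq_empty_or_nonempty
  · refine ⟨fiberPartition V fun _ => (), ThreeGraph.isAlmostGoodPartition_of_prediction
      (σ := fun _ _ => False) hη (by simp), (card_fiberPartition_le V _).trans ?_⟩
    exact Nat.one_le_pow _ _ (Nat.succ_pos _)
  have hp1 : 1 / (2 * (ℓ : ℝ)) ≤ 1 := by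
    have : (1 : ℝ) ≤ ℓ := mod_cast hℓ
    rw [div_le_one (by positivity)]; linarith
  obtain ⟨T, hTW, hTt, hT⟩ := exists_sample hW (U := U) (r := fun p z' =>
    (#(disagreement (fun z y => (H.slice p.1).Adj y z) V p.2 z') : ℝ) ≤ 2 * s * #V) hp1
    (fun x hx => (hred x hx).card_filter_few_close_le hs hs2 h𝒢) t
  obtain ⟨f, hf⟩ := exists_joint_clustering fun z hz =>
    exists_clustering_of_vcDim_slice_lt hq hq1 (hvc z (hTW hz)) U V
  obtain ⟨σ, hσ⟩ := exists_prediction (R := fun x y z => (H.slice x).Adj y z) (by positivity) hT hf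
  refine ⟨fiberPartition V f, ThreeGraph.isAlmostGoodPartition_of_prediction (σ := σ) hη ?_, ?_⟩
  · simp only [ThreeGraph.mem_nbhd]
    refine hσ.trans ?_
    have hTt' : (#T : ℝ) * (2 * q) ≤ t * (2 * q) := by gcongr
    gcongr
    linarith
  · calc #(fiberPartition V f).parts ≤ (packingBound k q + 1) ^ #T := by
          simpa using card_fiberPartition_le V f
      _ ≤ (packingBound k q + 1) ^ t := Nat.pow_le_pow_right (Nat.succ_pos _) hTt

end SliceClusters

section Parameters

open Filter Topology

variable {k ℓ : ℕ} {c s : ℝ}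

theorem muParam_pos (k : ℕ) (hc : 0 < c) {ε : ℝ} (hε : 0 < ε) : 0 < muParam k c ε := by
  unfold muParam; positivity

theorem muParam_sq (k : ℕ) (c : ℝ) (hs : 0 < s) :
    muParam k c (s ^ 2) = 8 * (16 * c ^ 4) ^ (1 / (4 * (k : ℝ) + 4)) *
      s ^ (1 / 8 * (1 / (4 * (k : ℝ) + 4))) := by
  have hsq : (s ^ 2) ^ (1 / 16 : ℝ) = s ^ (1 / 8 : ℝ) := by
    rw [← Real.rpow_natCast, ← Real.rpow_mul hs.le]; norm_num
  rw [muParam, hsq, show 16 * s ^ (1 / 8 : ℝ) * c ^ 4 = 16 * c ^ 4 * s ^ (1 / 8 : ℝ) by ring,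
    Real.mul_rpow (by positivity) (by positivity), Real.rpow_mul hs.le, mul_assoc]

theorem tendsto_rpow_nhdsGT_zero {a : ℝ} (ha : 0 < a) :
    Tendsto (fun s : ℝ => s ^ a) (𝓝[>] 0) (𝓝 0) := by
  have h := (Real.continuousAt_rpow_const 0 a (Or.inr ha.le)).tendsto
  rw [Real.zero_rpow ha.ne'] at h
  exact h.mono_left nhdsWithin_le_nhds

theorem tendsto_muParam_nhdsGT_zero (k : ℕ) (c : ℝ) :
    Tendsto (muParam k c) (𝓝[>] 0) (𝓝 0) := by
  have hexp : (0 : ℝ) < 1 / (4 * (k : ℝ) + 4) := by positivity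
  have h := ((((tendsto_rpow_nhdsGT_zero (a := 1 / 16) (by norm_num)).const_mul 16).mul_const
    (c ^ 4)).rpow_const (p := 1 / (4 * (k : ℝ) + 4)) (Or.inr hexp.le)).const_mul 8
  rwa [mul_zero, zero_mul, Real.zero_rpow hexp.ne', mul_zero] at h

theorem tendsto_sq_nhdsGT_zero : Tendsto (fun s : ℝ => s ^ 2) (𝓝[>] 0) (𝓝[>] 0) := by
  refine tendsto_nhdsWithin_iff.2
    ⟨?_, eventually_mem_nhdsWithin.mono fun s hs => Set.mem_Ioi.2 (pow_pos hs 2)⟩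
  simpa using ((continuous_pow (M := ℝ) 2).tendsto 0).mono_left nhdsWithin_le_nhds

theorem eventually_le_const_mul_inv_muParam_pow (hk : k ≠ 0) (hc : 0 < c) :
    ∀ᶠ ε in 𝓝[>] 0, 1 ≤ c * ((muParam k c ε / 8) ^ k)⁻¹ := by
  have h : Tendsto (fun ε => (muParam k c ε / 8) ^ k) (𝓝[>] 0) (𝓝 0) := by
    simpa [hk] using ((tendsto_muParam_nhdsGT_zero k c).div_const 8).pow k
  filter_upwards [h.eventually (gt_mem_nhds hc), eventually_mem_nhdsWithin] with ε hε hε0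
  have := muParam_pos k hc hε0
  rw [← div_eq_mul_inv, one_le_div (by positivity)]
  exact hε.le

theorem eventually_mul_le_muParam_rpow (k : ℕ) (hc : 0 < c) (D : ℝ) :
    ∀ᶠ s in 𝓝[>] 0, D * s ≤ (6 * muParam k c (s ^ 2) ^ (1 / 512 : ℝ)) ^ 3 := by
  set K := 8 * (16 * c ^ 4) ^ (1 / (4 * (k : ℝ) + 4)) with hK
  set a := 1 / 8 * (1 / (4 * (k : ℝ) + 4)) with ha
  have hK0 : 0 < K := by positivity
  have ha1 : a ≤ 1 := by
    have : 1 / (4 * (k : ℝ) + 4) ≤ 1 :=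
      div_le_one_of_le₀ (by linarith [Nat.cast_nonneg (α := ℝ) k]) (by positivity)
    linarith
  have hlim : Tendsto (fun s : ℝ => D * s ^ (1 / 2 : ℝ)) (𝓝[>] 0) (𝓝 0) := by
    simpa using (tendsto_rpow_nhdsGT_zero (a := 1 / 2) (by norm_num)).const_mul D
  have hsmall : ∀ᶠ s : ℝ in 𝓝[>] 0, s < 1 := nhdsWithin_le_nhds (gt_mem_nhds one_pos)
  filter_upwards [hlim.eventually (gt_mem_nhds (by positivity : 0 < 216 * K ^ (3 / 512 : ℝ))),
    hsmall, eventually_mem_nhdsWithin] with s hD hs1 hs0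
  rw [Set.mem_Ioi] at hs0
  have hsqrt : s = s ^ (1 / 2 : ℝ) * s ^ (1 / 2 : ℝ) := by
    rw [← Real.rpow_add hs0]; norm_num
  calc D * s = D * s ^ (1 / 2 : ℝ) * s ^ (1 / 2 : ℝ) := by rw [mul_assoc, ← hsqrt]
    _ ≤ 216 * K ^ (3 / 512 : ℝ) * s ^ (a * (1 / 512) * 3) := by
        refine mul_le_mul hD.le ?_ (by positivity) (by positivity)
        exact Real.rpow_le_rpow_of_exponent_ge hs0 hs1.le (by linarith)
    _ = (6 * muParam k c (s ^ 2) ^ (1 / 512 : ℝ)) ^ 3 := by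
        rw [muParam_sq k c hs0, ← hK, ← ha, Real.mul_rpow hK0.le (by positivity), mul_pow,
          mul_pow, ← Real.rpow_natCast (K ^ _), ← Real.rpow_mul hK0.le, ← Real.rpow_mul hs0.le,
          ← Real.rpow_natCast (s ^ _), ← Real.rpow_mul hs0.le]
        norm_num
        ring

theorem eventually_mul_pow_le_two_rpow (D : ℝ) (m : ℕ) :
    ∀ᶠ x : ℝ in atTop, D * x ^ m ≤ 2 ^ x := by
  have hlo := (isLittleO_pow_exp_pos_mul_atTop m (Real.log_pos one_lt_two)).const_mul_left D
  filter_upwards [hlo.bound one_pos] with x hx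
  rw [one_mul, Real.norm_eq_abs, Real.norm_eq_abs, Real.abs_exp,
    ← Real.rpow_def_of_pos two_pos] at hx
  exact (le_abs_self _).trans hx

theorem packingBound_sq_add_one_le (hs : 0 < s) (hs1 : s ≤ 1) :
    (packingBound k (s ^ 2) + 1 : ℝ) ≤ 2 * (18 * ((k : ℝ) + 1) ^ 2) ^ k * s⁻¹ ^ (4 * k) := by
  have hbound := calc
    (packingBound k (s ^ 2) : ℝ) ≤ (18 * ((k : ℝ) + 1) ^ 2 / (s ^ 2) ^ 2) ^ k :=
        packingBound_le (by positivity)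
    _ = (18 * ((k : ℝ) + 1) ^ 2) ^ k * s⁻¹ ^ (4 * k) := by
        rw [pow_mul, ← mul_pow, inv_pow, ← div_eq_mul_inv, ← pow_mul]
  have hone : 1 ≤ (18 * ((k : ℝ) + 1) ^ 2) ^ k * s⁻¹ ^ (4 * k) :=
    one_le_mul_of_one_le_of_one_le (one_le_pow₀ (by nlinarith [Nat.cast_nonneg (α := ℝ) k]))
      (one_le_pow₀ ((one_le_inv₀ hs).2 hs1))
  linarith

theorem eventually_packingBound_sq_le (k : ℕ) :
    ∀ᶠ s : ℝ in 𝓝[>] 0, (packingBound k (s ^ 2) + 1 : ℝ) ^ 2 ≤ 2 ^ s⁻¹ := by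
  have hsmall : ∀ᶠ s : ℝ in 𝓝[>] 0, s < 1 := nhdsWithin_le_nhds (gt_mem_nhds one_pos)
  filter_upwards [hsmall, eventually_mem_nhdsWithin, tendsto_inv_nhdsGT_zero.eventually
    (eventually_mul_pow_le_two_rpow ((2 * (18 * ((k : ℝ) + 1) ^ 2) ^ k) ^ 2) (4 * k * 2))]
    with s hs1 hs0 hs
  calc (packingBound k (s ^ 2) + 1 : ℝ) ^ 2
    _ ≤ (2 * (18 * ((k : ℝ) + 1) ^ 2) ^ k * s⁻¹ ^ (4 * k)) ^ 2 := by
        gcongr; exact packingBound_sq_add_one_le hs0 hs1.le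
    _ = (2 * (18 * ((k : ℝ) + 1) ^ 2) ^ k) ^ 2 * s⁻¹ ^ (4 * k * 2) := by rw [mul_pow, ← pow_mul]
    _ ≤ 2 ^ s⁻¹ := hs

theorem one_sub_pow_le_inv {p : ℝ} (hp : 0 < p) (hp1 : p ≤ 1) {t : ℕ} (ht : 0 < t) :
    (1 - p) ^ t ≤ (t * p)⁻¹ := by
  have : 0 < t * p := by positivity
  calc (1 - p) ^ t ≤ Real.exp (-(p * t)) := one_sub_pow_le_exp hp1 t
    _ = (Real.exp (t * p))⁻¹ := by rw [mul_comm, Real.exp_neg]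
    _ ≤ (t * p)⁻¹ := by gcongr; linarith [Real.add_one_le_exp (t * p)]

theorem sample_error_le (hℓ : 1 ≤ ℓ) (hs : 0 < s) (hs1 : s ≤ 1) :
    4 * s + (1 - 1 / (2 * (ℓ : ℝ))) ^ ⌈s⁻¹⌉₊ + ⌈s⁻¹⌉₊ * (2 * s ^ 2) ≤ (8 + 2 * (ℓ : ℝ)) * s := by
  have hℓ' : (1 : ℝ) ≤ ℓ := mod_cast hℓ
  set t := ⌈s⁻¹⌉₊
  have ht : s⁻¹ ≤ t := Nat.le_ceil _
  have ht0 : 0 < t := Nat.ceil_pos.2 (by positivity)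
  have hts : t * s ≤ 2 := calc
    t * s ≤ (s⁻¹ + 1) * s := by gcongr; exact (Nat.ceil_lt_add_one (by positivity)).le
    _ = 1 + s := by field_simp
    _ ≤ 2 := by linarith
  have hmiss : (1 - 1 / (2 * (ℓ : ℝ))) ^ t ≤ 2 * ℓ * s := calc
    _ ≤ (t * (1 / (2 * (ℓ : ℝ))))⁻¹ :=
        one_sub_pow_le_inv (by positivity) (div_le_one_of_le₀ (by linarith) (by positivity)) ht0
    _ = 2 * ℓ * (t : ℝ)⁻¹ := by field_simp
    _ ≤ 2 * ℓ * s := by gcongr; exact inv_le_of_inv_le₀ hs ht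
  nlinarith

theorem pow_ceil_inv_le_rpow {N b : ℝ} (hN : 1 ≤ N) (hb : 2 ≤ b) (hℓ : 1 ≤ ℓ) (hs : 0 < s)
    (hs1 : s ≤ 1) (h : N ^ 2 ≤ 2 ^ s⁻¹) :
    N ^ ⌈s⁻¹⌉₊ ≤ b ^ ((ℓ : ℝ) * (2 * (ℓ : ℝ)) ^ ℓ * ((s ^ 2) ^ ℓ)⁻¹) := by
  have hℓ' : (1 : ℝ) ≤ ℓ := mod_cast hℓ
  have hinv : 1 ≤ s⁻¹ := (one_le_inv₀ hs).2 hs1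
  have hceil : (⌈s⁻¹⌉₊ : ℝ) ≤ 2 * s⁻¹ := by
    linarith [Nat.ceil_lt_add_one (zero_le_one.trans hinv)]
  have hexp : s⁻¹ * s⁻¹ ≤ (ℓ : ℝ) * (2 * (ℓ : ℝ)) ^ ℓ * ((s ^ 2) ^ ℓ)⁻¹ := calc
    s⁻¹ * s⁻¹ = 1 * (s ^ 2)⁻¹ := by rw [sq, mul_inv, one_mul]
    _ ≤ (ℓ : ℝ) * (2 * (ℓ : ℝ)) ^ ℓ * ((s ^ 2) ^ ℓ)⁻¹ := by
        gcongr
        · exact one_le_mul_of_one_le_of_one_le hℓ' (one_le_pow₀ (by linarith))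
        · exact pow_le_of_le_one (by positivity) (pow_le_one₀ hs.le hs1) (by lia)
  calc N ^ ⌈s⁻¹⌉₊ = N ^ (⌈s⁻¹⌉₊ : ℝ) := (Real.rpow_natCast _ _).symm
    _ ≤ N ^ (2 * s⁻¹) := Real.rpow_le_rpow_of_exponent_le hN hceil
    _ = (N ^ 2) ^ s⁻¹ := by rw [Real.rpow_mul (by linarith), Real.rpow_two]
    _ ≤ (2 ^ s⁻¹) ^ s⁻¹ := by gcongr
    _ = 2 ^ (s⁻¹ * s⁻¹) := (Real.rpow_mul two_pos.le _ _).symm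
    _ ≤ b ^ (s⁻¹ * s⁻¹) := by gcongr
    _ ≤ _ := Real.rpow_le_rpow_of_exponent_le (by linarith) hexp

end Parameters

theorem ColoredBipartite.color_ne_two_of_card_nbhdRight_le {A B : Type*} [Fintype A]
    {G : ColoredBipartite A B} {ε : ℝ} {b : B} (hb : #(G.nbhdRight 2 b) ≤ ε * Fintype.card A)
    (hε : ε * Fintype.card A < 1) (a : A) : G.color a b ≠ 2 := fun hab => by
  have hpos : (1 : ℝ) ≤ #(G.nbhdRight 2 b) :=
    mod_cast card_pos.2 ⟨a, mem_filter.2 ⟨mem_univ a, hab⟩⟩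
  linarith

open Filter Topology in
theorem eventually_small {k : ℕ} (hk : k ≠ 0) {c : ℝ} (hc : 0 < c) (ℓ : ℕ) :
    ∀ᶠ s in 𝓝[>] 0, s ≤ 1 / 2 ∧ s ^ 2 * ((ℓ : ℝ) + 1) < 1 ∧
      (8 + 2 * (ℓ : ℝ)) * s ≤ (6 * muParam k c (s ^ 2) ^ (1 / 512 : ℝ)) ^ 3 ∧
      1 ≤ c * ((muParam k c (s ^ 2) / 8) ^ k)⁻¹ ∧
      (packingBound k (s ^ 2) + 1 : ℝ) ^ 2 ≤ 2 ^ s⁻¹ := by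
  have hhalf : ∀ᶠ s : ℝ in 𝓝[>] 0, s ≤ 1 / 2 := nhdsWithin_le_nhds (ge_mem_nhds (by norm_num))
  have hsq : Tendsto (fun s : ℝ => s ^ 2 * ((ℓ : ℝ) + 1)) (𝓝[>] 0) (𝓝 0) := by
    simpa using (tendsto_sq_nhdsGT_zero.mono_right nhdsWithin_le_nhds).mul_const ((ℓ : ℝ) + 1)
  exact hhalf.and <| (hsq.eventually (gt_mem_nhds one_pos)).and <|
    (eventually_mul_le_muParam_rpow k hc _).and <|
    (tendsto_sq_nhdsGT_zero.eventually (eventually_le_const_mul_inv_muParam_pow hk hc)).and <|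
    eventually_packingBound_sq_le k

end SliceReg

theorem proposition4p2_general {k : ℕ} (hk : 1 ≤ k) {c : ℝ} (hc : 0 < c) {ℓ : ℕ} (hℓ : 1 ≤ ℓ) :
    ∃ ε₀ : ℝ, 0 < ε₀ ∧ ∀ ε : ℝ, 0 < ε → ε < ε₀ → ∀ r s : ℕ, r ≤ ℓ →
    ∀ (α : Type*) [Fintype α] [DecidableEq α] (H : ThreeGraph α) (U V W : Finset α),
      (∀ z ∈ W, vcDim (H.slice z) < (k : ℕ∞)) →
    ∀ 𝒢 : ColoredBipartite (Fin (r + 1)) (Fin (s + 1)),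
      (∀ x ∈ U, IsReducedSlice H V W ℓ ε 𝒢 x) →
      (∀ j, j ≠ 0 → ((𝒢.nbhdRight 2 j).card : ℝ) ≤ ε * ((r : ℝ) + 1)) →
    ∃ P : Finpartition V,
      H.IsAlmostGoodPartition U W (6 * muParam k c ε ^ (1 / 512 : ℝ)) P ∧
      (P.parts.card : ℝ) ≤
        (2 * c * ((muParam k c ε / 8) ^ k)⁻¹) ^
          ((ℓ : ℝ) * (2 * (ℓ : ℝ)) ^ ℓ * (ε ^ ℓ)⁻¹) := by
  obtain ⟨w₀, hw₀, hsmall⟩ := mem_nhdsGT_iff_exists_Ioo_subset.1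
    (eventually_small (by lia : k ≠ 0) hc ℓ)
  rw [Set.mem_Ioi] at hw₀
  refine ⟨w₀ ^ 2, by positivity, fun ε hε hεw r s hr α _ _ H U V W hvc 𝒢 hred h𝒢 => ?_⟩
  obtain ⟨w, hw, rfl⟩ : ∃ w : ℝ, 0 < w ∧ w ^ 2 = ε := ⟨√ε, Real.sqrt_pos.2 hε, Real.sq_sqrt hε.le⟩
  obtain ⟨hw2, hwℓ, hη, hb, hN⟩ := hsmall ⟨hw, lt_of_pow_lt_pow_left₀ 2 hw₀.le hεw⟩
  have hμ := muParam_pos k hc hε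
  have hrℓ : w ^ 2 * ((r : ℝ) + 1) ≤ w ^ 2 * ((ℓ : ℝ) + 1) := by gcongr
  have hcolor (i j) (hj : j ≠ 0) : 𝒢.color i j ≠ 2 :=
    ColoredBipartite.color_ne_two_of_card_nbhdRight_le (ε := w ^ 2) (by simpa using h𝒢 j hj)
      (by simpa using hrℓ.trans_lt hwℓ) i
  obtain ⟨P, hP, hcard⟩ := exists_isAlmostGoodPartition hvc (q := w ^ 2) hε
    (pow_le_one₀ hw.le (by linarith)) hℓ hw hw2 hred hcolor ⌈w⁻¹⌉₊
    (η := 6 * muParam k c (w ^ 2) ^ (1 / 512 : ℝ)) (by positivity)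
    ((sample_error_le hℓ hw (by linarith)).trans hη)
  refine ⟨P, hP, le_trans (mod_cast hcard : (P.parts.card : ℝ) ≤ (packingBound k (w ^ 2) + 1) ^ _)
    (pow_ceil_inv_le_rpow (by simp) (by linarith) hℓ hw (by linarith) hN)⟩

theorem proposition4p2 (k : ℕ) (hk : 1 ≤ k) :
    (∃ c : ℝ, IsRemovalConstant k c) ∧
    ∀ c : ℝ, IsRemovalConstant k c →
    ∀ ℓ : ℕ, 1 ≤ ℓ →
    ∃ ε₀ : ℝ, 0 < ε₀ ∧ ∀ ε : ℝ, 0 < ε → ε < ε₀ →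
    ∃ n₀ : ℕ, ∀ r s : ℕ, 1 ≤ r → r ≤ ℓ → 1 ≤ s → s ≤ ℓ →
    ∀ (α : Type*) [Fintype α] [DecidableEq α] (H : ThreeGraph α) (U V W : Finset α),
      n₀ ≤ Fintype.card α →
      H.IsTripartite U V W →
      H.svc < (k : ℕ∞) →
    ∀ 𝒢 : ColoredBipartite (Fin (r + 1)) (Fin (s + 1)),
      (∀ x ∈ U, IsReducedSlice H V W ℓ ε 𝒢 x) →
      (∀ i, i ≠ 0 → ((𝒢.nbhdLeft 2 i).card : ℝ) ≤ ε * ((s : ℝ) + 1)) →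
      (∀ j, j ≠ 0 → ((𝒢.nbhdRight 2 j).card : ℝ) ≤ ε * ((r : ℝ) + 1)) →
    ∃ P : Finpartition V,
      H.IsAlmostGoodPartition U W (6 * muParam k c ε ^ (1 / 512 : ℝ)) P ∧
      (P.parts.card : ℝ) ≤
        (2 * c * ((muParam k c ε / 8) ^ k)⁻¹) ^
          ((ℓ : ℝ) * (2 * (ℓ : ℝ)) ^ ℓ * (ε ^ ℓ)⁻¹) :=
  ⟨⟨_, isRemovalConstant_removalConstant k⟩, fun c hc ℓ hℓ => by
    obtain ⟨ε₀, hε₀, h⟩ := proposition4p2_general hk hc.1 hℓ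
    exact ⟨ε₀, hε₀, fun ε hε hεε₀ => ⟨0, fun r s _ hr _ _ α _ _ H U V W _ _ hsvc 𝒢 hred _ hright =>
      h ε hε hεε₀ r s hr α H U V W (fun z _ => (le_iSup _ z).trans_lt hsvc) 𝒢 hred hright⟩⟩⟩
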